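/- **Setting.** Let $\alpha\in[1,2)$, let $c_1,\dots,c_N\in\mathbb R^2$ be distinct, $m_1,\dots,m_N>0$, $M=\sum_i m_i$, and let $R>0$ satisfy $R^\alpha<\frac{(2-\alpha)M}{2\alpha}$ (so that $R$ is smaller than the radius of the circular orbit of energy $-1$ for the potential $M/(\alpha|x|^\alpha)$). For $\varepsilon>0$ put $$V_\varepsilon(x)=\sum_{i=1}^N\frac{m_i}{\alpha|x-\varepsilon c_i|^\alpha},\qquad L([a,b];u)=\int_a^b\sqrt{V_\varepsilon(u)-1}\;|\dot u|\,dt ,$$ the length for the Jacobi metric $(V_\varepsilon-1)|dx|^2$ on $\{V_\varepsilon>1\}\setminus\{\varepsilon c_1,\dots,\varepsilon c_N\}$. "Solution at energy $-1$" means $\ddot y=\nabla V_\varepsilon(y)$, $\frac12|\dot y|^2-V_\varepsilon(y)=-1$. *Outer arcs.* Let $\delta>0$. For $p,q\in\partial B_R(0)$ with $|p-q|\le\delta$, $y_{\rm ext}(\cdot;p,q)$ on $[0,T_{\rm ext}(p,q)]$ is an outer arc from $p$ to $q$: a solution at energy $-1$ with $|y_{\rm ext}(t)|>R$ for $0<t<T_{\rm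 ext}(p,q)$. *Inner arcs.* For a partition $P$ of the centres into two non-empty blocks and $p,q\in\partial B_R(0)$, let $\widehat K_P^{pq}([a,b])$ be the set of curves $u\in H^1([a,b];\overline{B_R(0)})$ with $u(a)=p$, $u(b)=q$, without collisions, such that, after closing $u$ with the counterclockwise arc of $\partial B_R(0)$ from $q$ to $p$, the winding numbers around two centres have the same parity if and only if the two centres lie in the same block; let $K_P^{pq}([a,b])$ be its closure under weak $H^1$ limits of sequences. $y_P(\cdot;p,q)\in K_P^{pq}([0,T_P(p,q)])$ is an inner arc from $p$ to $q$: it solves the equations at energy $-1$ away from collisions, satisfies $|y_P(t)|<R$ for $0<t<T_P(p,q)$, and minimizes $L$ among all curves of $K_P^{pq}([a,b])$, $a<b$. One outer arc and one inner arc are fixed for all admissible $p,q$ and $P$; the choice is arbitrary if they are not unique. *The function $F$.* Let $n\ge1$ and partitions $P_1,\dots,P_n$ be given. On $$D=\{(p_0,\dots,p_{2n})\in(\partial B_R(0))^{2n+1}:\ p_{2n}=p_0,\ |p_{2j}-p_{2j+1}|\le\delta\ (0\le j<n)\}$$ let $$F(p_0,\dots,p_{2n})=\sum_{j=0}^{n-1}\Big(L\big(y_{\rm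 ext}(\cdot;p_{2j},p_{2j+1})\big)+L\big(y_{P_{j+1}}(\cdot;p_{2j+1},p_{2j+2})\big)\Big).$$ *The functions $G_k$.* Let $(\bar p_0,\dots,\bar p_{2n})\in D$ and $0\le k\le 2n-1$. Let $U$ be a neighbourhood of $\bar p_k$ which is strongly convex for the Jacobi metric: $\overline U$ is contained in the manifold, and any two points of $\overline U$ are joined by a unique minimal geodesic, whose interior lies in $U$. If $k=2j+1$, let $y=y_{P_{j+1}}(\cdot;\bar p_{2j+1},\bar p_{2j+2})$ with domain $[0,T]$, and let $t_*\in(0,T)$ be such that $\widetilde p_k:=y(t_*)\in U$, $|\widetilde p_k|<R$ and $R/2\le|y(t)|\le R$ on $[0,t_*]$. For $p\in D_k:=\{p\in\partial B_R(0)\cap\overline U:\ |\bar p_{2j}-p|\le\delta\}$ let $\widetilde y(\cdot;p,\widetilde p_k)$ be the unique minimal geodesic from $p$ to $\widetilde p_k$, lying in $U$ (except possibly for its ends), parametrized as a solution at energy $-1$, and put $$G_k(p)=L\big(y_{\rm ext}(\cdot;\bar p_{2j},p)\big)+L\big(\widetilde y(\cdot;p,\widetilde p_k)\big).$$ If $k=2j$,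 let $i=j-1$ for $j\ge1$ and $i=n-1$ for $j=0$, let $y=y_{P_{i+1}}(\cdot;\bar p_{2i+1},\bar p_{2i+2})$ with domain $[0,T]$ (so that $y(T)=\bar p_k$), and let $t_*\in(0,T)$ be such that $\widetilde p_k:=y(t_*)\in U$, $|\widetilde p_k|<R$ and $R/2\le|y(t)|\le R$ on $[t_*,T]$. For $p\in D_k:=\{p\in\partial B_R(0)\cap\overline U:\ |\bar p_{2j+1}-p|\le\delta\}$ put $$G_k(p)=L\big(\widetilde y(\cdot;\widetilde p_k,p)\big)+L\big(y_{\rm ext}(\cdot;p,\bar p_{2j+1})\big),$$ with $\widetilde y(\cdot;\widetilde p_k,p)$ the minimal geodesic from $\widetilde p_k$ to $p$, as above. **Statement.** There are $\varepsilon_0>0$ and $\rho>0$, depending only on $\alpha$, $R$, the masses $m_i$ and the centres $c_i$, such that for all $0<\varepsilon<\varepsilon_0$, all $\delta>0$ for which outer arcs exist as above (and with inner arcs as above), all $n\ge1$ and all partitions $P_1,\dots,P_n$ the following holds. If $(\bar p_0,\dots,\bar p_{2n})$ minimizes $F$ on $D$, then for every $k\in\{0,\dots,2n-1\}$ and all choices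 of $U\subset B_\rho(\bar p_k)$ and $t_*$ as above, $\bar p_k\in D_k$ and $\bar p_k$ minimizes $G_k$ on $D_k$. -/

import Mathlib

open Set Filter Topology MeasureTheory
open scoped ENNReal

/-- The data of a planar `N`-centre problem with homogeneous potentials of degree `-α`,
`α ∈ [1, 2)`: positive masses `m i` and pairwise distinct centres `c i` in the plane `ℂ`. -/
structure NCentre (N : ℕ) where
  α : ℝ
  m : Fin N → ℝ
  c : Fin N → ℂ
  one_le_α : 1 ≤ α
  α_lt_two : α < 2
  m_pos : ∀ i, 0 < m i
  c_injective : Function.Injective c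

/-- `u` belongs to `H¹([a,b]; ℂ)`, with weak derivative `g`. -/
def IsH1With (a b : ℝ) (u g : ℝ → ℂ) : Prop :=
  MemLp g 2 (volume.restrict (Icc a b)) ∧ ∀ t ∈ Icc a b, u t = u a + ∫ s in a..t, g s

/-- `u` belongs to `H¹([a,b]; ℂ)`. -/
def IsH1 (a b : ℝ) (u : ℝ → ℂ) : Prop := ∃ g, IsH1With a b u g

/-- On `[a,b]` the vector `γ t - z` has a continuous argument which grows by `2πw`; for a closed
curve `γ` avoiding `z` this says that `w` is the winding number of `γ` around `z`. -/
def HasWinding (γ : ℝ → ℂ) (a b : ℝ) (z : ℂ) (w : ℤ) : Prop :=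
  ∃ θ : ℝ → ℝ, ContinuousOn θ (Icc a b) ∧
    (∀ t ∈ Icc a b, γ t - z = (‖γ t - z‖ : ℂ) * Complex.exp ((θ t : ℂ) * Complex.I)) ∧
    θ b - θ a = 2 * Real.pi * w

/-- The curve `u` on `[a,b]` followed, on `[b,b+1]`, by the arc of the circle of radius `R` from the
angle `φ₂` to the angle `φ₁`. -/
noncomputable def closeUp (R φ₁ φ₂ b : ℝ) (u : ℝ → ℂ) (t : ℝ) : ℂ :=
  if t ≤ b then u t
  else (R : ℂ) * Complex.exp (((φ₂ + (t - b) * (φ₁ - φ₂) : ℝ) : ℂ) * Complex.I)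

/-- `x` is a minimizer of `f` on `A`. -/
def IsMinimizer {X : Type*} (f : X → ℝ≥0∞) (A : Set X) (x : X) : Prop :=
  x ∈ A ∧ IsMinOn f A x

namespace NCentre

variable {N : ℕ} (C : NCentre N)

/-- The total mass. -/
noncomputable def mass : ℝ := ∑ i, C.m i

/-- The rescaled centres `ε c i`. -/
noncomputable def centre (ε : ℝ) (i : Fin N) : ℂ := (ε : ℂ) * C.c i

/-- `V_ε(x) = ∑ i, m i / (α |x - ε c i| ^ α)`. -/
noncomputable def V (ε : ℝ) (x : ℂ) : ℝ := ∑ i, C.m i / (C.α * ‖x - C.centre ε i‖ ^ C.α)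

/-- The length `L([a,b]; u) = ∫ √(V_ε(u) - 1) |u'|` for the Jacobi metric at energy `-1`. -/
noncomputable def L (ε a b : ℝ) (u : ℝ → ℂ) : ℝ≥0∞ :=
  ∫⁻ t in Icc a b, ENNReal.ofReal (√(C.V ε (u t) - 1) * ‖deriv u t‖)

/-- On `[0,T]`, away from collisions, `y` solves `y'' = ∇V_ε(y)` with energy
`|y'|² / 2 - V_ε(y) = -1`. -/
def IsNewton (ε T : ℝ) (y : ℝ → ℂ) : Prop :=
  ∃ v : ℝ → ℂ, ∀ t ∈ Icc 0 T, (∀ i, y t ≠ C.centre ε i) →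
    HasDerivWithinAt y (v t) (Icc 0 T) t ∧
    HasDerivWithinAt v (gradient (C.V ε) (y t)) (Icc 0 T) t ∧
    ‖v t‖ ^ 2 / 2 - C.V ε (y t) = -1

/-! ### Outer arcs -/

/-- An outer arc from `p` to `q`: a solution at energy `-1` outside the ball of radius `R`. -/
def IsOuterArc (ε R : ℝ) (p q : ℂ) (T : ℝ) (y : ℝ → ℂ) : Prop :=
  0 < T ∧ ContinuousOn y (Icc 0 T) ∧ y 0 = p ∧ y T = q ∧ (∀ t ∈ Ioo 0 T, R < ‖y t‖) ∧
    C.IsNewton ε T y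

/-- `yext p q`, with domain `[0, Text p q]`, is an outer arc from `p` to `q` whenever `p, q` are
points of the circle of radius `R` at distance at most `δ`. -/
def IsOuterFamily (ε R δ : ℝ) (Text : ℂ → ℂ → ℝ) (yext : ℂ → ℂ → ℝ → ℂ) : Prop :=
  ∀ p ∈ Metric.sphere (0 : ℂ) R, ∀ q ∈ Metric.sphere (0 : ℂ) R, ‖p - q‖ ≤ δ →
    C.IsOuterArc ε R p q (Text p q) (yext p q)

/-! ### Inner arcs -/

/-- The collision-free `H¹` curves in the closed ball of radius `R` from `p` to `q` (two points of
its boundary) which separate the centres according to the partition `{S, Sᶜ}`: closing the curve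
by the counterclockwise arc of the circle from `q` to `p`, the winding numbers around two centres
have the same parity if and only if the centres lie in the same block. -/
def Khat (ε R : ℝ) (S : Set (Fin N)) (p q : ℂ) (a b : ℝ) (u : ℝ → ℂ) : Prop :=
  IsH1 a b u ∧ u a = p ∧ u b = q ∧ (∀ t ∈ Icc a b, ‖u t‖ ≤ R) ∧
  (∀ t ∈ Icc a b, ∀ i, u t ≠ C.centre ε i) ∧
  ∃ φ₁ φ₂ : ℝ, φ₂ ≤ φ₁ ∧ φ₁ < φ₂ + 2 * Real.pi ∧
    p = (R : ℂ) * Complex.exp ((φ₁ : ℂ) * Complex.I) ∧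
    q = (R : ℂ) * Complex.exp ((φ₂ : ℂ) * Complex.I) ∧
    ∃ w : Fin N → ℤ,
      (∀ i, HasWinding (closeUp R φ₁ φ₂ b u) a (b + 1) (C.centre ε i) (w i)) ∧
      ∀ i j, Even (w i - w j) ↔ (i ∈ S ↔ j ∈ S)

/-- The closure of `Khat` under weak limits of sequences in `H¹([a,b])` (uniform convergence with
bounded `L²` norms of the derivatives). Its elements may have collisions. -/
def K (ε R : ℝ) (S : Set (Fin N)) (p q : ℂ) (a b : ℝ) (u : ℝ → ℂ) : Prop :=
  IsH1 a b u ∧ ∃ (un gn : ℕ → ℝ → ℂ) (B : ℝ),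
    (∀ n, C.Khat ε R S p q a b (un n) ∧ IsH1With a b (un n) (gn n) ∧
      ∫⁻ t in Icc a b, ‖gn n t‖ₑ ^ 2 ≤ ENNReal.ofReal B) ∧
    TendstoUniformlyOn un u atTop (Icc a b)

/-- An inner arc from `p` to `q` for the partition `{S, Sᶜ}`: a solution at energy `-1` (possibly
with collisions) inside the ball of radius `R`, minimizing the Jacobi length in the class `K`. -/
def IsInnerArc (ε R : ℝ) (S : Set (Fin N)) (p q : ℂ) (T : ℝ) (y : ℝ → ℂ) : Prop :=
  0 < T ∧ (∀ t ∈ Ioo 0 T, ‖y t‖ < R) ∧ C.IsNewton ε T y ∧ C.K ε R S p q 0 T y ∧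
    ∀ (a b : ℝ) (u : ℝ → ℂ), a < b → C.K ε R S p q a b u → C.L ε 0 T y ≤ C.L ε a b u

/-- `yin S p q`, with domain `[0, Tin S p q]`, is an inner arc from `p` to `q` for `{S, Sᶜ}`, for
all partitions into two non-empty blocks and all points `p, q` of the circle of radius `R`. -/
def IsInnerFamily (ε R : ℝ) (Tin : Set (Fin N) → ℂ → ℂ → ℝ)
    (yin : Set (Fin N) → ℂ → ℂ → ℝ → ℂ) : Prop :=
  ∀ S : Set (Fin N), S.Nonempty → Sᶜ.Nonempty →
    ∀ p ∈ Metric.sphere (0 : ℂ) R, ∀ q ∈ Metric.sphere (0 : ℂ) R,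
      C.IsInnerArc ε R S p q (Tin S p q) (yin S p q)

/-! ### Jacobi metric: minimal geodesics and strongly convex sets -/

/-- The Riemannian manifold on which the Jacobi metric `(V_ε - 1) |dx|²` lives. -/
def jacobiDomain (ε : ℝ) : Set ℂ := {x | (∀ i, x ≠ C.centre ε i) ∧ 1 < C.V ε x}

/-- `u`, on `[a,b]`, is an `H¹` curve of the Jacobi manifold from `p` to `q`. -/
def IsJacobiPath (ε : ℝ) (p q : ℂ) (a b : ℝ) (u : ℝ → ℂ) : Prop :=
  IsH1 a b u ∧ u a = p ∧ u b = q ∧ ∀ t ∈ Icc a b, u t ∈ C.jacobiDomain ε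

/-- `u`, on `[a,b]`, has least Jacobi length among all curves of the manifold from `p` to `q`: up to
the parametrization it is a minimal geodesic. -/
def IsMinimalPath (ε : ℝ) (p q : ℂ) (a b : ℝ) (u : ℝ → ℂ) : Prop :=
  C.IsJacobiPath ε p q a b u ∧
    ∀ (a' b' : ℝ) (w : ℝ → ℂ), a' ≤ b' → C.IsJacobiPath ε p q a' b' w →
      C.L ε a b u ≤ C.L ε a' b' w

/-- `γ`, on `[0,ℓ]`, is a minimal geodesic from `p` to `q` parametrized by arc length. -/
def IsMinimalGeodesic (ε : ℝ) (p q : ℂ) (ℓ : ℝ) (γ : ℝ → ℂ) : Prop :=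
  0 ≤ ℓ ∧ C.IsMinimalPath ε p q 0 ℓ γ ∧ ∀ s ∈ Icc 0 ℓ, C.L ε 0 s γ = ENNReal.ofReal s

/-- `U` is strongly convex: any two points of its closure are joined by exactly one minimal
geodesic, and the interior of this geodesic lies in `U`. -/
def IsStronglyConvex (ε : ℝ) (U : Set ℂ) : Prop :=
  closure U ⊆ C.jacobiDomain ε ∧
  ∀ p ∈ closure U, ∀ q ∈ closure U, ∃ (ℓ : ℝ) (γ : ℝ → ℂ),
    C.IsMinimalGeodesic ε p q ℓ γ ∧ (∀ s ∈ Ioo 0 ℓ, γ s ∈ U) ∧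
    ∀ (ℓ' : ℝ) (γ' : ℝ → ℂ), C.IsMinimalGeodesic ε p q ℓ' γ' → ℓ' = ℓ ∧ EqOn γ' γ (Icc 0 ℓ)

/-- `y`, on `[0,T]`, is the minimal geodesic from `p` to `q`, lying in `U`, in the parametrization
that solves the equation of motion at energy `-1`. -/
def IsGeodesicArc (ε : ℝ) (U : Set ℂ) (p q : ℂ) (T : ℝ) (y : ℝ → ℂ) : Prop :=
  0 < T ∧ C.IsMinimalPath ε p q 0 T y ∧ (∀ t ∈ Ioo 0 T, y t ∈ U) ∧ C.IsNewton ε T y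

/-! ### The functions `F` and `G` -/

/-- The index `2 j`. -/
def ev {n : ℕ} (j : Fin n) : Fin (2 * n + 1) := ⟨2 * j, by omega⟩

/-- The index `2 j + 1`. -/
def od {n : ℕ} (j : Fin n) : Fin (2 * n + 1) := ⟨2 * j + 1, by omega⟩

/-- The index `2 j + 2`. -/
def ev' {n : ℕ} (j : Fin n) : Fin (2 * n + 1) := ⟨2 * j + 2, by omega⟩

/-- The domain of `F`: `(p 0, …, p (2n))` on the circle of radius `R` with `p (2n) = p 0` and
`|p (2j) - p (2j+1)| ≤ δ` for `j = 0, …, n - 1`. -/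
def domF (R δ : ℝ) (n : ℕ) : Set (Fin (2 * n + 1) → ℂ) :=
  {p | (∀ k, p k ∈ Metric.sphere (0 : ℂ) R) ∧ p (Fin.last (2 * n)) = p 0 ∧
    ∀ j : Fin n, ‖p (ev j) - p (od j)‖ ≤ δ}

/-- The total Jacobi length of the closed chain: outer arcs from `p (2j)` to `p (2j+1)`, inner arcs
for the `j`-th partition from `p (2j+1)` to `p (2j+2)`. -/
noncomputable def F (ε : ℝ) (Text : ℂ → ℂ → ℝ) (yext : ℂ → ℂ → ℝ → ℂ)
    (Tin : Set (Fin N) → ℂ → ℂ → ℝ) (yin : Set (Fin N) → ℂ → ℂ → ℝ → ℂ)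
    {n : ℕ} (S : Fin n → Set (Fin N)) (p : Fin (2 * n + 1) → ℂ) : ℝ≥0∞ :=
  ∑ j : Fin n,
    (C.L ε 0 (Text (p (ev j)) (p (od j))) (yext (p (ev j)) (p (od j))) +
      C.L ε 0 (Tin (S j) (p (od j)) (p (ev' j))) (yin (S j) (p (od j)) (p (ev' j))))

/-- The domain of the localized function: points of the circle of radius `R` in the closure of `U`
at distance at most `δ` from `q`, the other end of the outer arc. -/
def domG (R δ : ℝ) (U : Set ℂ) (q : ℂ) : Set ℂ :=
  {p | p ∈ Metric.sphere (0 : ℂ) R ∩ closure U ∧ ‖q - p‖ ≤ δ}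

/-- The function `G` for an odd index: the outer arc ends at the variable point `p`, from which the
geodesic `ygeo p` starts. -/
noncomputable def Godd (ε : ℝ) (Text : ℂ → ℂ → ℝ) (yext : ℂ → ℂ → ℝ → ℂ)
    (Tgeo : ℂ → ℝ) (ygeo : ℂ → ℝ → ℂ) (q p : ℂ) : ℝ≥0∞ :=
  C.L ε 0 (Text q p) (yext q p) + C.L ε 0 (Tgeo p) (ygeo p)

/-- The function `G` for an even index: the geodesic `ygeo p` ends at the variable point `p`, from
which the outer arc starts. -/
noncomputable def Geven (ε : ℝ) (Text : ℂ → ℂ → ℝ) (yext : ℂ → ℂ → ℝ → ℂ)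
    (Tgeo : ℂ → ℝ) (ygeo : ℂ → ℝ → ℂ) (q p : ℂ) : ℝ≥0∞ :=
  C.L ε 0 (Tgeo p) (ygeo p) + C.L ε 0 (Text p q) (yext p q)

end NCentre

/-! Move only the `k`-th point of a minimizing chain, to `x` say. All other arcs have finite length
and cancel in `F`, so minimality compares just one outer and one inner arc before and after the move
(`IsMargin.minimizer_odd`, `IsMargin.minimizer_even`).

Cut the old inner arc `y` at `ts` into a piece `X` near the circle and the rest `Y`. The geodesic
from the old point to `y ts` is no longer than `X`, because `X` is a competitor for it in the Jacobi
manifold. Conversely, the geodesic between `x` and `y ts`, joined to `Y`, competes with the new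
inner arc. Inserting both bounds and cancelling the finite length of `Y` gives the inequality for
`G` (`add_le_add_of_add_le_of_split`).

The substance is that this second competitor is admissible, that is, lies in `K`. It stays in the
closed ball because `|x|²` is convex along solutions of energy `-1` near the circle, whose radius is
below that of the circular orbit (`two_mul_V_add_inner_gradient_nonneg`, `IsNewton.norm_le`); this
determines `ρ`. It has the right topology because the curve is changed only outside a disc
containing all centres, so all winding numbers change by the same integer and the parities of their
differences survive (`exists_hasWinding_of_eqOn`, `Khat.of_eqOn`). Finally `y` may have collisions
and is only a limit of curves of `Khat`, so the surgery is carried out on the approximating curves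
(`K.of_eqOn`); rests of unit time, which cost no length, leave room to absorb the approximation
error at the junctions. -/

/-! ### Curves of class `H¹` -/

/-- `u ∈ H¹([a,b])` has a weak derivative whose squared `L²` norm is at most `B`. -/
def HasH1Bound (a b : ℝ) (u : ℝ → ℂ) (B : ℝ≥0∞) : Prop :=
  ∃ g, IsH1With a b u g ∧ ∫⁻ t in Icc a b, ‖g t‖ₑ ^ 2 ≤ B

theorem lintegral_enorm_sq_lt_top {a b : ℝ} {g : ℝ → ℂ}
    (hg : MemLp g 2 (volume.restrict (Icc a b))) : ∫⁻ t in Icc a b, ‖g t‖ₑ ^ 2 < ⊤ := by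
  have h := lintegral_rpow_enorm_lt_top_of_eLpNorm_lt_top (by norm_num) (by norm_num) hg.2
  simpa using h

namespace IsH1With

variable {a b c : ℝ} {u v g h : ℝ → ℂ}

theorem integrableOn (hu : IsH1With a b u g) : IntegrableOn g (Icc a b) :=
  hu.1.integrable (by norm_num)

theorem intervalIntegrable (hu : IsH1With a b u g) {s t : ℝ} (hs : s ∈ Icc a b)
    (ht : t ∈ Icc a b) : IntervalIntegrable g volume s t :=
  (hu.integrableOn.mono_set (uIcc_subset_Icc hs ht)).intervalIntegrable

theorem continuousOn (hu : IsH1With a b u g) : ContinuousOn u (Icc a b) := by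
  rcases le_or_gt a b with hab | hab
  · have h1 : ContinuousOn (fun t => u a + ∫ s in a..t, g s) (Icc a b) := by
      refine continuousOn_const.add ?_
      rw [← uIcc_of_le hab]
      exact intervalIntegral.continuousOn_primitive_interval
        ((uIcc_of_le hab).symm ▸ hu.integrableOn)
    exact h1.congr hu.2
  · rw [Icc_eq_empty (not_le.2 hab)]; exact continuousOn_empty u

theorem mono (hu : IsH1With a b u g) {s t : ℝ} (hs : s ∈ Icc a b) (ht : t ∈ Icc a b) :
    IsH1With s t u g := by
  refine ⟨hu.1.mono_measure (Measure.restrict_mono (Icc_subset_Icc hs.1 ht.2) le_rfl), ?_⟩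
  intro x hx
  have hx' : x ∈ Icc a b := ⟨hs.1.trans hx.1, hx.2.trans ht.2⟩
  have ha : a ∈ Icc a b := ⟨le_rfl, hs.1.trans hs.2⟩
  rw [hu.2 x hx', hu.2 s hs, add_assoc, intervalIntegral.integral_add_adjacent_intervals
    (hu.intervalIntegrable ha hs) (hu.intervalIntegrable hs hx')]

theorem congr (hu : IsH1With a b u g) (hab : a ≤ b) (huv : EqOn v u (Icc a b)) :
    IsH1With a b v g :=
  ⟨hu.1, fun t ht => by rw [huv ht, huv ⟨le_rfl, hab⟩, hu.2 t ht]⟩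

theorem trans (hu : IsH1With a b u g) (hv : IsH1With b c u h) (hab : a ≤ b) (hbc : b ≤ c) :
    IsH1With a c u (fun t => if t ≤ b then g t else h t) := by
  set k : ℝ → ℂ := fun t => if t ≤ b then g t else h t
  have hkg : EqOn k g (Iic b) := fun t ht => if_pos ht
  have hkh : EqOn k h (Ioi b) := fun t ht => if_neg (not_le.2 ht)
  have h1 : MemLp k 2 (volume.restrict (Icc a b)) :=
    (memLp_congr_ae (ae_restrict_of_forall_mem measurableSet_Icc fun t ht => hkg ht.2)).2 hu.1
  have h2 : MemLp k 2 (volume.restrict (Ioc b c)) :=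
    (memLp_congr_ae (ae_restrict_of_forall_mem measurableSet_Ioc fun t ht => hkh ht.1)).2
      (hv.1.mono_measure (Measure.restrict_mono Ioc_subset_Icc_self le_rfl))
  have hk : MemLp k 2 (volume.restrict (Icc a c)) := by
    rw [← Icc_union_Ioc_eq_Icc hab hbc]
    have hm := aestronglyMeasurable_union_iff.2 ⟨h1.1, h2.1⟩
    rw [memLp_two_iff_integrable_sq_norm h1.1] at h1
    rw [memLp_two_iff_integrable_sq_norm h2.1] at h2
    exact (memLp_two_iff_integrable_sq_norm hm).2 (IntegrableOn.union h1 h2)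
  have hI : ∀ x ∈ Icc a b, ∫ s in a..x, k s = ∫ s in a..x, g s := fun x hx =>
    intervalIntegral.integral_congr fun s hs => by
      rw [uIcc_of_le hx.1] at hs; exact hkg (hs.2.trans hx.2)
  have hJ : ∀ x ∈ Icc b c, ∫ s in b..x, k s = ∫ s in b..x, h s := fun x hx => by
    refine intervalIntegral.integral_congr_ae (Eventually.of_forall fun s hs => ?_)
    rw [uIoc_of_le hx.1] at hs; exact hkh hs.1
  refine ⟨hk, fun t ht => ?_⟩
  rcases le_total t b with htb | hbt
  · rw [hI t ⟨ht.1, htb⟩, hu.2 t ⟨ht.1, htb⟩]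
  · have hik : IntegrableOn k (Icc a c) := hk.integrable (by norm_num)
    have hi : ∀ x ∈ Icc a c, ∀ y ∈ Icc a c, IntervalIntegrable k volume x y := fun x hx y hy =>
      (hik.mono_set (uIcc_subset_Icc hx hy)).intervalIntegrable
    rw [← intervalIntegral.integral_add_adjacent_intervals (hi a ⟨le_rfl, hab.trans hbc⟩ b
      ⟨hab, hbc⟩) (hi b ⟨hab, hbc⟩ t ht), hI b ⟨hab, le_rfl⟩, hJ t ⟨hbt, ht.2⟩, ← add_assoc,
      ← hu.2 b ⟨hab, le_rfl⟩, hv.2 t ⟨hbt, ht.2⟩]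

theorem affine (z w : ℂ) (s : ℝ) : IsH1With a b (fun t => z + (t - s : ℝ) * w) (fun _ => w) := by
  refine ⟨memLp_const w, fun t _ => ?_⟩
  simp only [intervalIntegral.integral_const, Complex.real_smul]
  push_cast; ring

theorem shift (hu : IsH1With a b u g) (s : ℝ) :
    IsH1With (a + s) (b + s) (fun t => u (t - s)) (fun t => g (t - s)) := by
  have hmp : MeasurePreserving (fun t : ℝ => t - s) (volume.restrict (Icc (a + s) (b + s)))
      (volume.restrict (Icc a b)) := by
    have := (measurePreserving_sub_right (volume : Measure ℝ) s).restrict_preimage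
      (measurableSet_Icc (a := a) (b := b))
    simpa using this
  refine ⟨hu.1.comp_measurePreserving hmp, fun t ht => ?_⟩
  simp only
  rw [hu.2 (t - s) ⟨by linarith [ht.1], by linarith [ht.2]⟩,
    intervalIntegral.integral_comp_sub_right (fun x => g x) s]
  simp

/-- Lebesgue differentiation of the primitive of `g`. It links the weak derivative, which defines
`H¹`, to `deriv`, which defines `L`. -/
theorem ae_deriv_eq (hu : IsH1With a b u g) (hab : a ≤ b) :
    ∀ᵐ t ∂(volume.restrict (Ioo a b)), deriv u t = g t := by
  rw [ae_restrict_iff' measurableSet_Ioo]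
  have ha : a ∈ Icc a b := ⟨le_rfl, hab⟩
  have hi := hu.intervalIntegrable ha ⟨hab, le_rfl⟩
  filter_upwards [hi.ae_hasDerivAt_integral] with t ht htab
  rw [uIcc_of_le hab] at ht
  have h1 := (ht (Ioo_subset_Icc_self htab) a ha).const_add (u a)
  refine (h1.congr_of_eventuallyEq ?_).deriv
  filter_upwards [Icc_mem_nhds htab.1 htab.2] with x hx using hu.2 x hx

end IsH1With

namespace HasH1Bound

variable {a b c : ℝ} {u v : ℝ → ℂ} {B B' : ℝ≥0∞}

theorem trans (hu : HasH1Bound a b u B) (hv : HasH1Bound b c u B') (hab : a ≤ b) (hbc : b ≤ c) :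
    HasH1Bound a c u (B + B') := by
  obtain ⟨g, hg, hgB⟩ := hu
  obtain ⟨h, hh, hhB⟩ := hv
  refine ⟨_, hg.trans hh hab hbc, ?_⟩
  rw [← Icc_union_Ioc_eq_Icc hab hbc]
  refine (lintegral_union_le _ _ _).trans (add_le_add ?_ ?_)
  · refine le_trans (le_of_eq ?_) hgB
    exact setLIntegral_congr_fun measurableSet_Icc fun t ht => by simp [ht.2]
  · refine le_trans (le_of_eq ?_) ((lintegral_mono_set Ioc_subset_Icc_self).trans hhB)
    exact setLIntegral_congr_fun measurableSet_Ioc fun t ht => by simp [not_le.2 ht.1]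

theorem mono (hu : HasH1Bound a b u B) {s t : ℝ} (hs : s ∈ Icc a b) (ht : t ∈ Icc a b) :
    HasH1Bound s t u B := by
  obtain ⟨g, hg, hgB⟩ := hu
  exact ⟨g, hg.mono hs ht, (lintegral_mono_set (Icc_subset_Icc hs.1 ht.2)).trans hgB⟩

theorem congr (hu : HasH1Bound a b u B) (hab : a ≤ b) (huv : EqOn v u (Icc a b)) :
    HasH1Bound a b v B := by
  obtain ⟨g, hg, hgB⟩ := hu
  exact ⟨g, hg.congr hab huv, hgB⟩

theorem affine (z w : ℂ) (s : ℝ) :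
    HasH1Bound a b (fun t => z + (t - s : ℝ) * w) (‖w‖ₑ ^ 2 * ENNReal.ofReal (b - a)) :=
  ⟨_, IsH1With.affine z w s, by simp⟩

end HasH1Bound

namespace IsH1

variable {a b c : ℝ} {u v : ℝ → ℂ}

theorem hasH1Bound (hu : IsH1 a b u) : ∃ B : ℝ≥0∞, B ≠ ⊤ ∧ HasH1Bound a b u B := by
  obtain ⟨g, hg⟩ := hu
  exact ⟨_, (lintegral_enorm_sq_lt_top hg.1).ne, g, hg, le_rfl⟩

theorem continuousOn (hu : IsH1 a b u) : ContinuousOn u (Icc a b) :=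
  hu.choose_spec.continuousOn

theorem mono (hu : IsH1 a b u) {s t : ℝ} (hs : s ∈ Icc a b) (ht : t ∈ Icc a b) : IsH1 s t u :=
  hu.imp fun _ hg => hg.mono hs ht

theorem congr (hu : IsH1 a b u) (hab : a ≤ b) (huv : EqOn v u (Icc a b)) : IsH1 a b v :=
  hu.imp fun _ hg => hg.congr hab huv

theorem trans (hu : IsH1 a b u) (hv : IsH1 b c u) (hab : a ≤ b) (hbc : b ≤ c) : IsH1 a c u := by
  obtain ⟨g, hg⟩ := hu
  obtain ⟨h, hh⟩ := hv
  exact ⟨_, hg.trans hh hab hbc⟩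

theorem shift (hu : IsH1 a b u) (s : ℝ) : IsH1 (a + s) (b + s) (fun t => u (t - s)) := by
  obtain ⟨g, hg⟩ := hu
  exact ⟨_, hg.shift s⟩

theorem const (z : ℂ) : IsH1 a b (fun _ => z) := by
  have h := IsH1With.affine (a := a) (b := b) z 0 0
  simp only [mul_zero, add_zero] at h
  exact ⟨_, h⟩

end IsH1

/-! ### The Jacobi length -/

namespace NCentre

variable {N : ℕ} (C : NCentre N) {ε a b c : ℝ} {u v : ℝ → ℂ}

/-- The value of `deriv` at an end point depends on `u` outside the interval. As end points are null
sets, `L` depends only on `u` in the open interval, which is what allows cutting and pasting. -/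
theorem L_eq_Ioo (ε a b : ℝ) (u : ℝ → ℂ) :
    C.L ε a b u = ∫⁻ t in Ioo a b, ENNReal.ofReal (√(C.V ε (u t) - 1) * ‖deriv u t‖) := by
  rw [L, restrict_Ioo_eq_restrict_Icc]

theorem L_add (hab : a ≤ b) (hbc : b ≤ c) (u : ℝ → ℂ) :
    C.L ε a c u = C.L ε a b u + C.L ε b c u := by
  have h : C.L ε b c u =
      ∫⁻ t in Ioc b c, ENNReal.ofReal (√(C.V ε (u t) - 1) * ‖deriv u t‖) := by
    rw [L, restrict_Ioc_eq_restrict_Icc]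
  rw [h, L, L, ← Icc_union_Ioc_eq_Icc hab hbc, lintegral_union measurableSet_Ioc]
  exact Set.disjoint_left.2 fun x hx hx' => absurd hx.2 (not_le.2 hx'.1)

theorem L_congr (huv : EqOn u v (Ioo a b)) : C.L ε a b u = C.L ε a b v := by
  rw [L_eq_Ioo, L_eq_Ioo]
  refine setLIntegral_congr_fun measurableSet_Ioo fun t ht => ?_
  have : u =ᶠ[𝓝 t] v := by filter_upwards [isOpen_Ioo.mem_nhds ht] with x hx using huv hx
  simp only [this.deriv_eq, huv ht]

theorem L_shift (ε a b s : ℝ) (u : ℝ → ℂ) :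
    C.L ε (a + s) (b + s) (fun t => u (t - s)) = C.L ε a b u := by
  have hmp : MeasurePreserving (fun t : ℝ => t - s) (volume.restrict (Icc (a + s) (b + s)))
      (volume.restrict (Icc a b)) := by
    have := (measurePreserving_sub_right (volume : Measure ℝ) s).restrict_preimage
      (measurableSet_Icc (a := a) (b := b))
    simpa using this
  have he : MeasurableEmbedding (fun t : ℝ => t - s) :=
    (Homeomorph.subRight s).measurableEmbedding
  rw [L, L, ← hmp.lintegral_comp_emb he]
  simp only [deriv_comp_sub_const]

theorem L_const (ε a b : ℝ) (z : ℂ) : C.L ε a b (fun _ => z) = 0 := by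
  simp [L]

theorem L_lt_top_of_bound {B : ℝ} {g : ℝ → ℂ} (hu : IsH1With a b u g) (hab : a ≤ b)
    (hV : ∀ t ∈ Icc a b, C.V ε (u t) ≤ B) : C.L ε a b u < ⊤ := by
  have h1 : C.L ε a b u ≤ ∫⁻ t in Ioo a b, ENNReal.ofReal (√(B - 1)) * ‖g t‖ₑ := by
    rw [L_eq_Ioo]
    refine setLIntegral_mono_ae' measurableSet_Ioo ?_
    have h := hu.ae_deriv_eq hab
    rw [ae_restrict_iff' measurableSet_Ioo] at h
    filter_upwards [h] with t ht htab
    rw [ht htab, ENNReal.ofReal_mul (Real.sqrt_nonneg _), ofReal_norm]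
    gcongr
    exact hV t (Ioo_subset_Icc_self htab)
  refine h1.trans_lt ?_
  rw [lintegral_const_mul' _ _ ENNReal.ofReal_ne_top]
  refine ENNReal.mul_lt_top ENNReal.ofReal_lt_top ?_
  exact (hu.integrableOn.mono_set Ioo_subset_Icc_self).2

end NCentre

/-! ### Increments of the argument along a curve -/

/-- Along `γ` on `[a,b]` the vector `γ t - z` has a continuous argument with increment `Δ`. -/
def HasArgIncrement (γ : ℝ → ℂ) (a b : ℝ) (z : ℂ) (Δ : ℝ) : Prop :=
  ∃ θ : ℝ → ℝ, ContinuousOn θ (Icc a b) ∧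
    (∀ t ∈ Icc a b, γ t - z = (‖γ t - z‖ : ℂ) * Complex.exp ((θ t : ℂ) * Complex.I)) ∧
    θ b - θ a = Δ

theorem exp_mul_I_eq_of_polar {w : ℂ} (hw : w ≠ 0) {x y : ℝ}
    (hx : w = (‖w‖ : ℂ) * Complex.exp ((x : ℂ) * Complex.I))
    (hy : w = (‖w‖ : ℂ) * Complex.exp ((y : ℂ) * Complex.I)) :
    ∃ k : ℤ, x = y + 2 * Real.pi * k := by
  have hn : (‖w‖ : ℂ) ≠ 0 := by exact_mod_cast norm_ne_zero_iff.2 hw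
  have h : Complex.exp ((x : ℂ) * Complex.I) = Complex.exp ((y : ℂ) * Complex.I) :=
    mul_left_cancel₀ hn (hx.symm.trans hy)
  obtain ⟨k, hk⟩ := Complex.exp_eq_exp_iff_exists_int.1 h
  refine ⟨k, ?_⟩
  have h2 : (x : ℂ) = ((y + 2 * Real.pi * k : ℝ) : ℂ) := by
    apply mul_right_cancel₀ Complex.I_ne_zero
    rw [hk]; push_cast; ring
  exact_mod_cast h2

/-- Extended by constants, `γ - z` is a nowhere vanishing function on the simply connected line and
has a continuous logarithm, whose imaginary part is the argument. -/
theorem exists_hasArgIncrement {γ : ℝ → ℂ} {a b : ℝ} {z : ℂ} (hab : a ≤ b)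
    (hγ : ContinuousOn γ (Icc a b)) (hz : ∀ t ∈ Icc a b, γ t ≠ z) :
    ∃ Δ, HasArgIncrement γ a b z Δ := by
  have hc : Continuous (IccExtend hab ((Icc a b).domRestrict γ)) :=
    (continuousOn_iff_continuous_domRestrict.1 hγ).Icc_extend'
  have : ContractibleSpace (univ : Set ℝ) := convex_univ.contractibleSpace univ_nonempty
  have hu : IsSimplyConnected (univ : Set ℝ) :=
    inferInstanceAs (SimplyConnectedSpace (univ : Set ℝ))
  obtain ⟨f, hf, hfe⟩ := Complex.exists_continuousOn_eqOn_exp_comp hu isOpen_univ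
    (g := fun t => IccExtend hab ((Icc a b).domRestrict γ) t - z)
    (hc.sub continuous_const).continuousOn (by
      rintro ⟨t, -, ht⟩
      exact hz _ (projIcc a b hab t).2 (sub_eq_zero.1 ht))
  refine ⟨_, fun t => (f t).im, ?_, fun t ht => ?_, rfl⟩
  · exact Complex.continuous_im.comp_continuousOn (hf.mono (subset_univ _))
  · have h := hfe (mem_univ t)
    simp only [Function.comp, IccExtend_of_mem hab _ ht, domRestrict_apply] at h
    rw [← h, Complex.norm_exp, Complex.ofReal_exp, ← Complex.exp_add, Complex.re_add_im]

namespace HasArgIncrement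

variable {γ γ' : ℝ → ℂ} {a b c : ℝ} {z z' : ℂ} {Δ Δ' : ℝ}

theorem congr (h : HasArgIncrement γ a b z Δ) (hγ : EqOn γ' γ (Icc a b)) :
    HasArgIncrement γ' a b z Δ := by
  obtain ⟨θ, h1, h2, h3⟩ := h
  exact ⟨θ, h1, fun t ht => by rw [hγ ht]; exact h2 t ht, h3⟩

theorem split (h : HasArgIncrement γ a c z Δ) (hab : a ≤ b) (hbc : b ≤ c) :
    ∃ Δ₁ Δ₂, HasArgIncrement γ a b z Δ₁ ∧ HasArgIncrement γ b c z Δ₂ ∧ Δ = Δ₁ + Δ₂ := by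
  obtain ⟨θ, h1, h2, rfl⟩ := h
  exact ⟨_, _, ⟨θ, h1.mono (Icc_subset_Icc_right hbc), fun t ht => h2 t ⟨ht.1, ht.2.trans hbc⟩, rfl⟩,
    ⟨θ, h1.mono (Icc_subset_Icc_left hab), fun t ht => h2 t ⟨hab.trans ht.1, ht.2⟩, rfl⟩, by ring⟩

theorem trans (h : HasArgIncrement γ a b z Δ) (h' : HasArgIncrement γ b c z Δ') (hab : a ≤ b)
    (hbc : b ≤ c) (hb : γ b ≠ z) : HasArgIncrement γ a c z (Δ + Δ') := by
  obtain ⟨θ, h1, h2, rfl⟩ := h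
  obtain ⟨η, g1, g2, rfl⟩ := h'
  obtain ⟨k, hk⟩ := exp_mul_I_eq_of_polar (sub_ne_zero.2 hb) (h2 b ⟨hab, le_rfl⟩)
    (g2 b ⟨le_rfl, hbc⟩)
  set f : ℝ → ℝ := fun t => if t ≤ b then θ t else η t + 2 * Real.pi * k with hf
  have hf1 : EqOn f θ (Icc a b) := fun t ht => if_pos ht.2
  have hf2 : EqOn f (fun t => η t + 2 * Real.pi * k) (Icc b c) := fun t ht => by
    rcases eq_or_lt_of_le ht.1 with rfl | hlt
    · simp [hf, hk]
    · exact if_neg (not_le.2 hlt)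
  refine ⟨f, ?_, fun t ht => ?_, ?_⟩
  · rw [← Icc_union_Icc_eq_Icc hab hbc]
    exact (h1.congr hf1).union_of_isClosed ((g1.add continuousOn_const).congr hf2) isClosed_Icc
      isClosed_Icc
  · rcases le_total t b with htb | hbt
    · rw [hf1 ⟨ht.1, htb⟩]; exact h2 t ⟨ht.1, htb⟩
    · rw [hf2 ⟨hbt, ht.2⟩]
      have : (((η t + 2 * Real.pi * k : ℝ) : ℂ) * Complex.I) =
          (η t : ℂ) * Complex.I + k * (2 * Real.pi * Complex.I) := by push_cast; ring
      rw [this, Complex.exp_add, Complex.exp_int_mul_two_pi_mul_I, mul_one]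
      exact g2 t ⟨hbt, ht.2⟩
  · rw [hf1 ⟨le_rfl, hab⟩, hf2 ⟨hbc, le_rfl⟩, hk]; ring

/-- The difference of two continuous arguments, divided by `2π`, is continuous with values in the
totally disconnected set of integers, hence constant. -/
theorem unique (h : HasArgIncrement γ a b z Δ) (h' : HasArgIncrement γ a b z Δ') (hab : a ≤ b)
    (hz : ∀ t ∈ Icc a b, γ t ≠ z) : Δ = Δ' := by
  obtain ⟨θ, h1, h2, rfl⟩ := h
  obtain ⟨η, g1, g2, rfl⟩ := h'
  have hk : ∀ t ∈ Icc a b, ∃ k : ℤ, θ t = η t + 2 * Real.pi * k := fun t ht =>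
    exp_mul_I_eq_of_polar (sub_ne_zero.2 (hz t ht)) (h2 t ht) (g2 t ht)
  have hpi := Real.two_pi_pos
  have hc : ContinuousOn (fun t => (θ t - η t) / (2 * Real.pi)) (Icc a b) :=
    (h1.sub g1).div_const _
  have hr : ∀ t ∈ Icc a b, (θ t - η t) / (2 * Real.pi) ∈ range ((↑) : ℤ → ℝ) := fun t ht => by
    obtain ⟨k, hk⟩ := hk t ht
    exact ⟨k, by rw [hk]; field_simp; ring⟩
  have hd : IsTotallyDisconnected (range ((↑) : ℤ → ℝ)) :=
    (countable_range _).isTotallyDisconnected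
  have hsub := hd _ (image_subset_iff.2 hr) (isPreconnected_Icc.image _ hc)
  have he := hsub (mem_image_of_mem _ (⟨hab, le_rfl⟩ : b ∈ Icc a b))
    (mem_image_of_mem _ (⟨le_rfl, hab⟩ : a ∈ Icc a b))
  have := (div_left_inj' hpi.ne').1 he
  linarith

theorem exists_int (h : HasArgIncrement γ a b z Δ) (hab : a ≤ b) (hγ : γ a = γ b)
    (hz : γ a ≠ z) : ∃ k : ℤ, Δ = 2 * Real.pi * k := by
  obtain ⟨θ, h1, h2, rfl⟩ := h
  have h3 := h2 b ⟨hab, le_rfl⟩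
  rw [← hγ] at h3
  obtain ⟨k, hk⟩ := exp_mul_I_eq_of_polar (sub_ne_zero.2 hz) h3 (h2 a ⟨le_rfl, hab⟩)
  exact ⟨k, by rw [hk]; ring⟩

/-- If `γ - z'` is `γ - z` times a factor with continuous argument `A`, the arguments add. -/
theorem change_centre (h : HasArgIncrement γ a b z Δ) {A : ℝ → ℝ} (hA : ContinuousOn A (Icc a b))
    (hzA : ∀ t ∈ Icc a b, ∃ r : ℝ, 0 ≤ r ∧
      γ t - z' = (γ t - z) * ((r : ℂ) * Complex.exp ((A t : ℂ) * Complex.I))) :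
    HasArgIncrement γ a b z' (Δ + (A b - A a)) := by
  obtain ⟨θ, h1, h2, rfl⟩ := h
  refine ⟨fun t => θ t + A t, h1.add hA, fun t ht => ?_, by ring⟩
  obtain ⟨r, hr, he⟩ := hzA t ht
  have hn : ‖γ t - z'‖ = ‖γ t - z‖ * r := by
    rw [he, norm_mul, norm_mul, Complex.norm_exp_ofReal_mul_I, mul_one, Complex.norm_of_nonneg hr]
  rw [hn]
  conv_lhs => rw [he, h2 t ht]
  push_cast
  rw [add_mul, Complex.exp_add]; ring

end HasArgIncrement

/-- The increments of the argument around all points of a disc along a curve outside the disc. -/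
theorem exists_forall_hasArgIncrement {γ : ℝ → ℂ} {a b r : ℝ} (hab : a ≤ b)
    (hγ : ContinuousOn γ (Icc a b)) (hr : ∀ t ∈ Icc a b, r ≤ ‖γ t‖) :
    ∃ E : ℝ, ∀ z : ℂ, ‖z‖ < r →
      HasArgIncrement γ a b z (E + ((1 - z / γ b).arg - (1 - z / γ a).arg)) := by
  rcases le_or_gt r 0 with hr0 | hr0
  · exact ⟨0, fun z hz => absurd hz (not_lt.2 (hr0.trans (norm_nonneg z)))⟩
  have h0 : ∀ t ∈ Icc a b, γ t ≠ 0 := fun t ht => norm_pos_iff.1 (hr0.trans_le (hr t ht))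
  obtain ⟨E, hE⟩ := exists_hasArgIncrement hab hγ h0
  refine ⟨E, fun z hz => ?_⟩
  have hlt : ∀ t ∈ Icc a b, ‖z / γ t‖ < 1 := fun t ht => by
    rw [norm_div, div_lt_one (norm_pos_iff.2 (h0 t ht))]; exact hz.trans_le (hr t ht)
  -- Factor `γ - z = γ (1 - z / γ)`. Since `|z / γ| < 1`, the second factor has positive real part,
  -- so its principal argument is continuous.
  refine hE.change_centre (A := fun t => (1 - z / γ t).arg) ?_ fun t ht => ?_
  · intro t ht
    have hs : (1 - z / γ t) ∈ Complex.slitPlane := by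
      refine Complex.mem_slitPlane_iff.2 (Or.inl ?_)
      have := (Complex.re_le_norm (z / γ t)).trans_lt (hlt t ht)
      simp only [Complex.sub_re, Complex.one_re]; linarith
    exact (Complex.continuousAt_arg hs).comp_continuousWithinAt (f := fun t => 1 - z / γ t)
      (continuousWithinAt_const.sub (continuousWithinAt_const.div (hγ t ht) (h0 t ht)))
  · refine ⟨‖1 - z / γ t‖, norm_nonneg _, ?_⟩
    rw [Complex.norm_mul_exp_arg_mul_I]
    have := h0 t ht
    field_simp
    ring

/-- Let a closed curve be changed outside a disc only, keeping a common middle piece: all winding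
numbers around points of the disc change by the same integer. -/
theorem exists_hasWinding_of_eqOn {γ γ' : ℝ → ℂ} {a b a' b' s₁ s₂ r : ℝ} {ι : Type*} {z : ι → ℂ}
    {w : ι → ℤ} (has : a ≤ s₁) (has' : a' ≤ s₁) (hs : s₁ ≤ s₂) (hsb : s₂ ≤ b) (hsb' : s₂ ≤ b')
    (hz : ∀ i, ‖z i‖ < r)
    (hγ : ContinuousOn γ (Icc a b)) (hγ' : ContinuousOn γ' (Icc a' b'))
    (hr : ∀ t ∈ Icc a s₁ ∪ Icc s₂ b, r ≤ ‖γ t‖) (hr' : ∀ t ∈ Icc a' s₁ ∪ Icc s₂ b', r ≤ ‖γ' t‖)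
    (heq : EqOn γ' γ (Icc s₁ s₂)) (hab : γ a = γ b) (hab' : γ' a' = γ' b') (hw : ∀ i, HasWinding γ a b (z i) (w i)) :
    ∃ w' : ι → ℤ, (∀ i, HasWinding γ' a' b' (z i) (w' i)) ∧ ∀ i j, w' i - w' j = w i - w j := by
  have hne : ∀ {x : ℂ} i, r ≤ ‖x‖ → x ≠ z i := fun i hx h => by
    rw [h] at hx; exact absurd (hz i) (not_lt.2 hx)
  obtain ⟨E₁, hE₁⟩ := exists_forall_hasArgIncrement has (hγ.mono (Icc_subset_Icc_right (hs.trans hsb)))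
    fun t ht => hr t (Or.inl ht)
  obtain ⟨E₂, hE₂⟩ := exists_forall_hasArgIncrement hsb (hγ.mono (Icc_subset_Icc_left (has.trans hs)))
    fun t ht => hr t (Or.inr ht)
  obtain ⟨E₁', hE₁'⟩ := exists_forall_hasArgIncrement has'
    (hγ'.mono (Icc_subset_Icc_right (hs.trans hsb'))) fun t ht => hr' t (Or.inl ht)
  obtain ⟨E₂', hE₂'⟩ := exists_forall_hasArgIncrement hsb'
    (hγ'.mono (Icc_subset_Icc_left (has'.trans hs))) fun t ht => hr' t (Or.inr ht)
  -- The correction terms depending on the centre all cancel: at the ends because the curves are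
  -- closed, at `s₁` and `s₂` because the two curves agree there. What remains involves only the
  -- increments `E`, which are the same for all centres.
  have key : ∀ i, ∃ k : ℤ, HasWinding γ' a' b' (z i) k ∧
      2 * Real.pi * (k - w i : ℝ) = E₁' + E₂' - (E₁ + E₂) := by
    intro i
    have hab₀ := has.trans (hs.trans hsb)
    have hab₀' := has'.trans (hs.trans hsb')
    obtain ⟨Δ₁, Δ', h₁, h', h12⟩ := HasArgIncrement.split (hw i) has (hs.trans hsb)
    obtain ⟨Δ₂, Δ₃, h₂, h₃, h23⟩ := h'.split hs hsb
    have e₁ := h₁.unique (hE₁ _ (hz i)) has fun t ht => hne i (hr t (Or.inl ht))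
    have e₃ := h₃.unique (hE₂ _ (hz i)) hsb fun t ht => hne i (hr t (Or.inr ht))
    have hnew := (hE₁' _ (hz i)).trans ((h₂.congr heq).trans (hE₂' _ (hz i)) hs hsb'
      (hne i (hr' s₂ (Or.inr ⟨le_rfl, hsb'⟩)))) has' (hs.trans hsb')
      (hne i (hr' s₁ (Or.inl ⟨has', le_rfl⟩)))
    obtain ⟨k, hk⟩ := hnew.exists_int hab₀' hab' (hne i (hr' a' (Or.inl ⟨le_rfl, has'⟩)))
    refine ⟨k, ?_, ?_⟩
    · rw [hk] at hnew; exact hnew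
    · rw [heq ⟨le_rfl, hs⟩, heq ⟨hs, le_rfl⟩, hab'] at hk
      rw [hab] at e₁
      linarith
  choose k hk hkE using key
  refine ⟨k, hk, fun i j => ?_⟩
  have h : 2 * Real.pi * (k i - w i : ℝ) = 2 * Real.pi * (k j - w j : ℝ) := by
    rw [hkE, hkE]
  have h2 := mul_left_cancel₀ Real.two_pi_pos.ne' h
  have h3 : k i - w i = k j - w j := by exact_mod_cast h2
  linarith

/-! ### Closing up curves -/

section closeUp

variable {R φ₁ φ₂ a b t : ℝ} {u : ℝ → ℂ}

theorem closeUp_of_le (h : t ≤ b) : closeUp R φ₁ φ₂ b u t = u t := if_pos h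

theorem closeUp_of_ge (hu : u b = (R : ℂ) * Complex.exp ((φ₂ : ℂ) * Complex.I)) (h : b ≤ t) :
    closeUp R φ₁ φ₂ b u t =
      (R : ℂ) * Complex.exp (((φ₂ + (t - b) * (φ₁ - φ₂) : ℝ) : ℂ) * Complex.I) := by
  rcases eq_or_lt_of_le h with rfl | h
  · rw [closeUp_of_le le_rfl, hu]; simp
  · exact if_neg (not_le.2 h)

theorem continuousOn_closeUp (hab : a ≤ b) (hc : ContinuousOn u (Icc a b))
    (hu : u b = (R : ℂ) * Complex.exp ((φ₂ : ℂ) * Complex.I)) :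
    ContinuousOn (closeUp R φ₁ φ₂ b u) (Icc a (b + 1)) := by
  rw [← Icc_union_Icc_eq_Icc hab (by linarith : b ≤ b + 1)]
  refine (hc.congr fun t ht => closeUp_of_le ht.2).union_of_isClosed
    (ContinuousOn.congr ?_ fun t ht => closeUp_of_ge hu ht.1) isClosed_Icc isClosed_Icc
  fun_prop

theorem norm_closeUp_of_ge (hR : 0 ≤ R)
    (hu : u b = (R : ℂ) * Complex.exp ((φ₂ : ℂ) * Complex.I)) (h : b ≤ t) :
    ‖closeUp R φ₁ φ₂ b u t‖ = R := by
  rw [closeUp_of_ge hu h, norm_mul, Complex.norm_exp_ofReal_mul_I, mul_one,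
    Complex.norm_of_nonneg hR]

theorem closeUp_end (hab : a ≤ b) (ha : u a = (R : ℂ) * Complex.exp ((φ₁ : ℂ) * Complex.I))
    (hu : u b = (R : ℂ) * Complex.exp ((φ₂ : ℂ) * Complex.I)) :
    closeUp R φ₁ φ₂ b u a = closeUp R φ₁ φ₂ b u (b + 1) := by
  rw [closeUp_of_le hab, closeUp_of_ge hu (by linarith), ha]
  simp

theorem exists_polar_angles {p q : ℂ} (hp : ‖p‖ = R) (hq : ‖q‖ = R) :
    ∃ φ₁ φ₂ : ℝ, φ₂ ≤ φ₁ ∧ φ₁ < φ₂ + 2 * Real.pi ∧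
      p = (R : ℂ) * Complex.exp ((φ₁ : ℂ) * Complex.I) ∧
      q = (R : ℂ) * Complex.exp ((φ₂ : ℂ) * Complex.I) := by
  have h := toIcoMod_mem_Ico Real.two_pi_pos q.arg p.arg
  refine ⟨_, _, h.1, h.2, ?_, by rw [← hq, Complex.norm_mul_exp_arg_mul_I]⟩
  have he : (((toIcoMod Real.two_pi_pos q.arg p.arg : ℝ) : ℂ) * Complex.I) = p.arg * Complex.I -
      (toIcoDiv Real.two_pi_pos q.arg p.arg : ℤ) * (2 * Real.pi * Complex.I) := by
    rw [toIcoMod]; simp only [zsmul_eq_mul]; push_cast; ring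
  rw [he, Complex.exp_sub, Complex.exp_int_mul_two_pi_mul_I, div_one, ← hp,
    Complex.norm_mul_exp_arg_mul_I]

end closeUp

/-! ### Changing the ends of curves which separate the centres -/

namespace NCentre

variable {N : ℕ} {C : NCentre N} {ε R r r' a b a' b' s₁ s₂ : ℝ} {S : Set (Fin N)} {p q : ℂ}
  {u u' : ℝ → ℂ}

/-- Both the new end pieces and the closing arc avoid the disc of radius `r`, so the winding numbers
shift by a common integer, and `Khat` constrains only the parity of their differences. -/
theorem Khat.of_eqOn (hu : C.Khat ε R S p q a b u) (has : a ≤ s₁) (has' : a' ≤ s₁) (hs : s₁ ≤ s₂)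
    (hsb : s₂ ≤ b) (hsb' : s₂ ≤ b') (hc : ∀ i, ‖C.centre ε i‖ < r)
    (hr : ∀ t ∈ Icc a s₁ ∪ Icc s₂ b, r ≤ ‖u t‖) (hu' : IsH1 a' b' u')
    (hr' : ∀ t ∈ Icc a' s₁ ∪ Icc s₂ b', r ≤ ‖u' t‖) (hR' : ∀ t ∈ Icc a' s₁ ∪ Icc s₂ b', ‖u' t‖ ≤ R)
    (heq : EqOn u' u (Icc s₁ s₂)) (hp' : ‖u' a'‖ = R) (hq' : ‖u' b'‖ = R) :
    C.Khat ε R S (u' a') (u' b') a' b' u' := by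
  obtain ⟨hu1, hua, hub, huR, huc, φ₁, φ₂, -, -, hp, hq, w, hw, hpar⟩ := hu
  obtain ⟨ψ₁, ψ₂, hψ, hψ', hp₁, hq₁⟩ := exists_polar_angles hp' hq'
  have hR : 0 ≤ R := hp' ▸ norm_nonneg _
  have hab := has.trans (hs.trans hsb)
  have hab' := has'.trans (hs.trans hsb')
  have hcase : ∀ t ∈ Icc a' b', t ∈ Icc a' s₁ ∪ Icc s₂ b' ∨ t ∈ Icc s₁ s₂ := fun t ht => by
    rcases le_total t s₁ with h | h
    · exact Or.inl (Or.inl ⟨ht.1, h⟩)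
    · rcases le_total t s₂ with h' | h'
      · exact Or.inr ⟨h, h'⟩
      · exact Or.inl (Or.inr ⟨h', ht.2⟩)
  have hsub : Icc s₁ s₂ ⊆ Icc a b := Icc_subset_Icc has hsb
  have hrR : r ≤ R := hq' ▸ hr' b' (Or.inr ⟨hsb', le_rfl⟩)
  rw [← hua] at hp
  rw [← hub] at hq
  have hA : ∀ t ∈ Icc a s₁ ∪ Icc s₂ (b + 1), r ≤ ‖closeUp R φ₁ φ₂ b u t‖ := by
    rintro t (ht | ht)
    · rw [closeUp_of_le (ht.2.trans (hs.trans hsb))]; exact hr t (Or.inl ht)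
    · rcases le_total t b with h | h
      · rw [closeUp_of_le h]; exact hr t (Or.inr ⟨ht.1, h⟩)
      · rw [norm_closeUp_of_ge hR hq h]; exact hrR
  have hB : ∀ t ∈ Icc a' s₁ ∪ Icc s₂ (b' + 1), r ≤ ‖closeUp R ψ₁ ψ₂ b' u' t‖ := by
    rintro t (ht | ht)
    · rw [closeUp_of_le (ht.2.trans (hs.trans hsb'))]; exact hr' t (Or.inl ht)
    · rcases le_total t b' with h | h
      · rw [closeUp_of_le h]; exact hr' t (Or.inr ⟨ht.1, h⟩)
      · rw [norm_closeUp_of_ge hR hq₁ h]; exact hrR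
  have hE : EqOn (closeUp R ψ₁ ψ₂ b' u') (closeUp R φ₁ φ₂ b u) (Icc s₁ s₂) := fun t ht => by
    rw [closeUp_of_le (ht.2.trans hsb), closeUp_of_le (ht.2.trans hsb'), heq ht]
  obtain ⟨w', hw', hww⟩ := exists_hasWinding_of_eqOn has has' hs (by linarith) (by linarith) hc
    (continuousOn_closeUp hab hu1.continuousOn hq)
    (continuousOn_closeUp hab' hu'.continuousOn hq₁) hA hB hE (closeUp_end hab hp hq)
    (closeUp_end hab' hp₁ hq₁) hw
  refine ⟨hu', rfl, rfl, fun t ht => ?_, fun t ht i => ?_, ψ₁, ψ₂, hψ, hψ', hp₁, hq₁, w', hw',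
    fun i j => by rw [hww]; exact hpar i j⟩
  · rcases hcase t ht with h | h
    · exact hR' t h
    · rw [heq h]; exact huR t (hsub h)
  · rcases hcase t ht with h | h
    · intro he
      exact absurd (hr' t h) (not_le.2 (he ▸ hc i))
    · rw [heq h]; exact huc t (hsub h) i

/-- The curve `v` on `[s₁,s₂]`, continued by a correction of `y'` on both sides which moves
`y' s₁`, `y' s₂` to `v s₁`, `v s₂` if `y'` is constant near these times. -/
noncomputable def graft (s₁ s₂ : ℝ) (y' v : ℝ → ℂ) (t : ℝ) : ℂ :=
  if t ≤ s₁ then y' t + (max 0 (t - (s₁ - 1)) : ℝ) * (v s₁ - y' s₁)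
  else if t ≤ s₂ then v t
  else y' t + (max 0 (s₂ + 1 - t) : ℝ) * (v s₂ - y' s₂)

section graft

variable {y' v : ℝ → ℂ} {t : ℝ}

theorem graft_of_le (h : t ≤ s₁) : graft s₁ s₂ y' v t =
    y' t + (max 0 (t - (s₁ - 1)) : ℝ) * (v s₁ - y' s₁) := if_pos h

theorem graft_of_mem (h : t ∈ Icc s₁ s₂) : graft s₁ s₂ y' v t = v t := by
  rcases eq_or_lt_of_le h.1 with rfl | h1
  · rw [graft_of_le le_rfl]; simp
  · rw [graft, if_neg (not_le.2 h1), if_pos h.2]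

theorem graft_of_ge (hs : s₁ ≤ s₂) (h : s₂ ≤ t) : graft s₁ s₂ y' v t =
    y' t + (max 0 (s₂ + 1 - t) : ℝ) * (v s₂ - y' s₂) := by
  rcases eq_or_lt_of_le h with rfl | h1
  · rw [graft_of_mem ⟨hs, le_rfl⟩]; simp
  · rw [graft, if_neg (not_le.2 (hs.trans_lt h1)), if_neg (not_le.2 h1)]

theorem norm_graft_sub_le {η : ℝ} (hs : s₁ ≤ s₂) (hη : ∀ t ∈ Icc s₁ s₂, ‖v t - y' t‖ ≤ η) (t : ℝ) :
    ‖graft s₁ s₂ y' v t - y' t‖ ≤ η := by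
  have aux : ∀ (x : ℝ) (w : ℂ), x ≤ 1 → ‖w‖ ≤ η → ‖((max 0 x : ℝ) : ℂ) * w‖ ≤ η := by
    intro x w hx hw
    rw [norm_mul, Complex.norm_of_nonneg (le_max_left 0 x)]
    have h1 : max 0 x ≤ 1 := max_le zero_le_one hx
    calc max 0 x * ‖w‖ ≤ 1 * ‖w‖ := by gcongr
      _ ≤ η := by rwa [one_mul]
  rcases le_total t s₁ with h | h
  · rw [graft_of_le h, add_sub_cancel_left]
    exact aux _ _ (by linarith) (hη _ ⟨le_rfl, hs⟩)
  · rcases le_total t s₂ with h' | h'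
    · rw [graft_of_mem ⟨h, h'⟩]; exact hη _ ⟨h, h'⟩
    · rw [graft_of_ge hs h', add_sub_cancel_left]
      exact aux _ _ (by linarith) (hη _ ⟨hs, le_rfl⟩)

/-- The correction acts only while `y'` rests, where the graft is a convex combination of two points
of the ball. Without the rests it could push `y'` across the circle. -/
theorem norm_graft_le (hs : s₁ ≤ s₂) (hy : ∀ t ∈ Icc a' s₁ ∪ Icc s₂ b', ‖y' t‖ ≤ R)
    (hv : ∀ t ∈ Icc s₁ s₂, ‖v t‖ ≤ R)
    (has' : a' ≤ s₁) (hsb' : s₂ ≤ b')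
    (hc₁ : ∀ t ∈ Icc (s₁ - 1) s₁, y' t = y' s₁) (hc₂ : ∀ t ∈ Icc s₂ (s₂ + 1), y' t = y' s₂) :
    ∀ t ∈ Icc a' s₁ ∪ Icc s₂ b', ‖graft s₁ s₂ y' v t‖ ≤ R := by
  have aux : ∀ (x : ℝ) (z w : ℂ), 0 ≤ x → x ≤ 1 → ‖z‖ ≤ R → ‖w‖ ≤ R →
      ‖z + (x : ℂ) * (w - z)‖ ≤ R := by
    intro x z w hx hx1 hz hw
    have he : z + (x : ℂ) * (w - z) = ((1 - x : ℝ) : ℂ) * z + (x : ℂ) * w := by push_cast; ring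
    rw [he]
    refine (norm_add_le _ _).trans ?_
    rw [norm_mul, norm_mul, Complex.norm_of_nonneg hx, Complex.norm_of_nonneg (by linarith)]
    nlinarith
  rintro t (ht | ht)
  · rw [graft_of_le ht.2]
    rcases le_total t (s₁ - 1) with h | h
    · rw [max_eq_left (by linarith)]
      simpa using hy t (Or.inl ht)
    · rw [max_eq_right (by linarith), hc₁ t ⟨h, ht.2⟩]
      exact aux _ _ _ (by linarith) (by linarith [ht.2]) (hy _ (Or.inl ⟨has', le_rfl⟩))
        (hv _ ⟨le_rfl, hs⟩)
  · rw [graft_of_ge hs ht.1]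
    rcases le_total (s₂ + 1) t with h | h
    · rw [max_eq_left (by linarith)]
      simpa using hy t (Or.inr ht)
    · rw [max_eq_right (by linarith), hc₂ t ⟨ht.1, h⟩]
      exact aux _ _ _ (by linarith) (by linarith [ht.1]) (hy _ (Or.inr ⟨le_rfl, hsb'⟩))
        (hv _ ⟨hs, le_rfl⟩)

/-- The bound depends on `v` only through `B`, hence is uniform along an approximating sequence.
Each `1` comes from a correction of speed at most `1` during unit time. -/
theorem hasH1Bound_graft {B B' : ℝ≥0∞} (hs : s₁ ≤ s₂) (has' : a' ≤ s₁ - 1) (hsb' : s₂ + 1 ≤ b')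
    (hy : HasH1Bound a' b' y' B') (hv : HasH1Bound s₁ s₂ v B)
    (hc₁ : ∀ t ∈ Icc (s₁ - 1) s₁, y' t = y' s₁) (hc₂ : ∀ t ∈ Icc s₂ (s₂ + 1), y' t = y' s₂)
    (h₁ : ‖v s₁ - y' s₁‖ ≤ 1) (h₂ : ‖v s₂ - y' s₂‖ ≤ 1) :
    HasH1Bound a' b' (graft s₁ s₂ y' v) (B' + (1 + (B + (1 + B')))) := by
  have aff : ∀ (c d : ℝ) (z w : ℂ) (s : ℝ), ‖w‖ ≤ 1 → d - c = 1 →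
      HasH1Bound c d (fun t => z + (t - s : ℝ) * w) 1 := by
    intro c d z w s hw hcd
    obtain ⟨g, hg, hgB⟩ := HasH1Bound.affine (a := c) (b := d) z w s
    refine ⟨g, hg, hgB.trans ?_⟩
    rw [hcd, ENNReal.ofReal_one, mul_one]
    refine pow_le_one₀ (by simp) ?_
    rw [← ofReal_norm]; exact ENNReal.ofReal_le_one.2 hw
  have p₁ : HasH1Bound a' (s₁ - 1) (graft s₁ s₂ y' v) B' :=
    (hy.mono ⟨le_rfl, by linarith⟩ ⟨has', by linarith⟩).congr has' fun t ht => by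
      rw [graft_of_le (by linarith [ht.2]), max_eq_left (by linarith [ht.2])]; simp
  have p₂ : HasH1Bound (s₁ - 1) s₁ (graft s₁ s₂ y' v) 1 :=
    (aff (s₁ - 1) s₁ (y' s₁) _ (s₁ - 1) h₁ (by ring)).congr (by linarith) fun t ht => by
      rw [graft_of_le ht.2, max_eq_right (by linarith [ht.1]), hc₁ t ht]
  have p₃ : HasH1Bound s₁ s₂ (graft s₁ s₂ y' v) B :=
    hv.congr hs fun t ht => graft_of_mem ht
  have p₄ : HasH1Bound s₂ (s₂ + 1) (graft s₁ s₂ y' v) 1 :=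
    (aff s₂ (s₂ + 1) (y' s₂) (-(v s₂ - y' s₂)) (s₂ + 1) (by rwa [norm_neg]) (by ring)).congr
      (by linarith) fun t ht => by
      rw [graft_of_ge hs ht.1, max_eq_right (by linarith [ht.2]), hc₂ t ht]
      push_cast; ring
  have p₅ : HasH1Bound (s₂ + 1) b' (graft s₁ s₂ y' v) B' :=
    (hy.mono ⟨by linarith, hsb'⟩ ⟨by linarith, le_rfl⟩).congr hsb' fun t ht => by
      rw [graft_of_ge hs (by linarith [ht.1]), max_eq_left (by linarith [ht.1])]; simp
  exact p₁.trans (p₂.trans (p₃.trans (p₄.trans p₅ (by linarith) hsb') hs (by linarith))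
    (by linarith) (by linarith)) has' (by linarith)

end graft

/-- The curves of `Khat` that approximate `y` are grafted into `y'`. By `Khat.of_eqOn` the results
are again in the right class `Khat`, and they converge uniformly to `y'` with bounded `H¹` norms. -/
theorem K.of_eqOn {y y' : ℝ → ℂ} (hy : C.K ε R S p q a b y) (has : a ≤ s₁) (has' : a' ≤ s₁ - 1)
    (hs : s₁ ≤ s₂) (hsb : s₂ ≤ b) (hsb' : s₂ + 1 ≤ b') (hc : ∀ i, ‖C.centre ε i‖ < r) (hrr : r < r')
    (hr : ∀ t ∈ Icc a s₁ ∪ Icc s₂ b, r' ≤ ‖y t‖) (hy' : IsH1 a' b' y')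
    (hr' : ∀ t ∈ Icc a' s₁ ∪ Icc s₂ b', r' ≤ ‖y' t‖) (hR' : ∀ t ∈ Icc a' s₁ ∪ Icc s₂ b', ‖y' t‖ ≤ R)
    (heq : EqOn y' y (Icc s₁ s₂))
    (hc₁ : ∀ t ∈ Icc (s₁ - 1) s₁, y' t = y' s₁) (hc₂ : ∀ t ∈ Icc s₂ (s₂ + 1), y' t = y' s₂)
    (hp' : ‖y' a'‖ = R) (hq' : ‖y' b'‖ = R) :
    C.K ε R S (y' a') (y' b') a' b' y' := by
  obtain ⟨-, un, gn, B, hun, hlim⟩ := hy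
  obtain ⟨B', hB', hyB'⟩ := hy'.hasH1Bound
  have hsub : Icc s₁ s₂ ⊆ Icc a b := Icc_subset_Icc has hsb
  -- Closeness `1` bounds the speed of the corrections; closeness `r' - r` keeps the end pieces
  -- outside the disc of radius `r`. Dropping the first `n₀` curves gives both for the whole
  -- sequence.
  obtain ⟨n₀, hn₀⟩ := eventually_atTop.1
    (Metric.tendstoUniformlyOn_iff.1 hlim (min 1 (r' - r)) (lt_min one_pos (by linarith)))
  have hclose : ∀ n, ∀ t ∈ Icc a b, ‖un (n + n₀) t - y t‖ ≤ min 1 (r' - r) := fun n t ht => by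
    rw [← dist_eq_norm, dist_comm]; exact (hn₀ _ (by omega) t ht).le
  have hclose' : ∀ n, ∀ t ∈ Icc s₁ s₂, ‖un (n + n₀) t - y' t‖ ≤ min 1 (r' - r) := fun n t ht => by
    rw [heq ht]; exact hclose n t (hsub ht)
  have hbd : ∀ n, HasH1Bound a' b' (graft s₁ s₂ y' (un (n + n₀)))
      (B' + (1 + (ENNReal.ofReal B + (1 + B')))) := fun n => by
    have h1 : HasH1Bound s₁ s₂ (un (n + n₀)) (ENNReal.ofReal B) :=
      HasH1Bound.mono ⟨gn _, (hun _).2.1, (hun _).2.2⟩ ⟨has, hs.trans hsb⟩ ⟨has.trans hs, hsb⟩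
    exact hasH1Bound_graft hs has' hsb' hyB' h1 hc₁ hc₂
      ((hclose' n s₁ ⟨le_rfl, hs⟩).trans (min_le_left _ _))
      ((hclose' n s₂ ⟨hs, le_rfl⟩).trans (min_le_left _ _))
  choose g hg hgB using hbd
  have ha : ∀ v, graft s₁ s₂ y' v a' = y' a' := fun v => by
    rw [graft_of_le (by linarith), max_eq_left (by linarith)]; simp
  have hb : ∀ v, graft s₁ s₂ y' v b' = y' b' := fun v => by
    rw [graft_of_ge hs (by linarith), max_eq_left (by linarith)]; simp
  refine ⟨hy', fun n => graft s₁ s₂ y' (un (n + n₀)), g,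
    (B' + (1 + (ENNReal.ofReal B + (1 + B')))).toReal, fun n => ⟨?_, hg n, ?_⟩, ?_⟩
  · have hK := Khat.of_eqOn (a' := a') (b' := b') (u' := graft s₁ s₂ y' (un (n + n₀)))
      (hun (n + n₀)).1 has (by linarith) hs hsb (by linarith) hc
      ?_ ⟨_, hg n⟩ ?_ ?_ (fun t ht => graft_of_mem ht) (by rw [ha, hp']) (by rw [hb, hq'])
    · rwa [ha, hb] at hK
    · intro t ht
      have htab : t ∈ Icc a b := by
        rcases ht with ht | ht
        · exact ⟨ht.1, ht.2.trans (hs.trans hsb)⟩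
        · exact ⟨has.trans (hs.trans ht.1), ht.2⟩
      have h1 := (hclose n t htab).trans (min_le_right _ _)
      have h2 := hr t ht
      have h3 := norm_sub_norm_le (y t) (un (n + n₀) t)
      rw [norm_sub_rev] at h3
      linarith
    · intro t ht
      have h1 := (norm_graft_sub_le hs (hclose' n) t).trans (min_le_right _ _)
      have h2 := hr' t ht
      have h3 := norm_sub_norm_le (y' t) (graft s₁ s₂ y' (un (n + n₀)) t)
      rw [norm_sub_rev] at h3
      linarith
    · exact norm_graft_le hs hR' (fun t ht => (hun (n + n₀)).1.2.2.2.1 t (hsub ht)) (by linarith)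
        (by linarith) hc₁ hc₂
  · rw [ENNReal.ofReal_toReal]
    · exact hgB n
    · simp [hB']
  · rw [Metric.tendstoUniformlyOn_iff] at hlim ⊢
    intro η hη
    have h1 := (tendsto_add_atTop_nat n₀).eventually (hlim (η / 2) (by linarith))
    filter_upwards [h1] with n hn t _
    rw [dist_comm, dist_eq_norm]
    refine (norm_graft_sub_le hs (η := η / 2) (fun s hs' => ?_) t).trans_lt (by linarith)
    rw [heq hs', ← dist_eq_norm, dist_comm]
    exact (hn s (hsub hs')).le

end NCentre

/-! ### The potential -/

namespace NCentre

variable {N : ℕ} (C : NCentre N) {ε R η a b T : ℝ} {S : Set (Fin N)} {p q x : ℂ} {u y : ℝ → ℂ}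

theorem α_pos : 0 < C.α := one_pos.trans_le C.one_le_α

theorem continuousAt_V (hx : ∀ i, x ≠ C.centre ε i) : ContinuousAt (C.V ε) x := by
  unfold V
  refine tendsto_finsetSum _ fun i _ => ?_
  have h0 : ‖x - C.centre ε i‖ ≠ 0 := norm_ne_zero_iff.2 (sub_ne_zero.2 (hx i))
  have h1 : ContinuousAt (fun x => ‖x - C.centre ε i‖ ^ C.α) x :=
    (continuousAt_id.sub continuousAt_const).norm.rpow_const (Or.inl h0)
  exact continuousAt_const.div (continuousAt_const.mul h1)
    (mul_ne_zero C.α_pos.ne' (by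
      rw [Ne, Real.rpow_eq_zero (norm_nonneg _) C.α_pos.ne']; exact h0))

theorem V_le_of_le_norm_sub {d : ℝ} (hd : 0 < d) (hx : ∀ i, d ≤ ‖x - C.centre ε i‖) :
    C.V ε x ≤ C.mass / (C.α * d ^ C.α) := by
  rw [mass, Finset.sum_div]
  refine Finset.sum_le_sum fun i _ => ?_
  have := C.α_pos
  have := (C.m_pos i).le
  gcongr
  exact hx i

theorem le_V_of_norm_sub_le {d : ℝ} (hx : ∀ i, x ≠ C.centre ε i)
    (hd : ∀ i, ‖x - C.centre ε i‖ ≤ d) : C.mass / (C.α * d ^ C.α) ≤ C.V ε x := by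
  rw [mass, Finset.sum_div]
  refine Finset.sum_le_sum fun i _ => ?_
  have h1 := C.α_pos
  have h2 := (C.m_pos i).le
  have h3 : 0 < ‖x - C.centre ε i‖ := norm_pos_iff.2 (sub_ne_zero.2 (hx i))
  gcongr
  exact hd i

/-- The squared norm is smooth, so this form can be differentiated directly. -/
theorem V_eq_sum_rpow (ε : ℝ) : C.V ε = fun x =>
    ∑ i, C.m i / C.α * (‖x - C.centre ε i‖ ^ 2) ^ (-C.α / 2) := by
  funext x
  refine Finset.sum_congr rfl fun i _ => ?_
  rw [← Real.rpow_natCast, ← Real.rpow_mul (norm_nonneg _)]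
  have : ((2 : ℕ) : ℝ) * (-C.α / 2) = -C.α := by push_cast; ring
  rw [this, Real.rpow_neg (norm_nonneg _), ← div_div, div_eq_mul_inv (C.m i / C.α)]

theorem inner_gradient_V (hx : ∀ i, x ≠ C.centre ε i) (w : ℂ) :
    inner ℝ (gradient (C.V ε) x) w =
      -∑ i, C.m i * inner ℝ (x - C.centre ε i) w / ‖x - C.centre ε i‖ ^ (C.α + 2) := by
  have hα := C.α_pos
  have hterm : ∀ i, HasFDerivAt
      (fun x => C.m i / C.α * (‖x - C.centre ε i‖ ^ 2) ^ (-C.α / 2))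
      ((-C.m i / ‖x - C.centre ε i‖ ^ (C.α + 2)) • innerSL ℝ (x - C.centre ε i)) x := fun i => by
    have hpos : 0 < ‖x - C.centre ε i‖ := norm_pos_iff.2 (sub_ne_zero.2 (hx i))
    have h1 : HasFDerivAt (fun x => ‖x - C.centre ε i‖ ^ 2)
        (2 • innerSL ℝ (x - C.centre ε i)) x := by
      simpa using ((hasFDerivAt_id x).sub_const (C.centre ε i)).norm_sq
    have h2 := (h1.rpow_const (p := -C.α / 2) (Or.inl (by positivity))).const_mul (C.m i / C.α)
    refine h2.congr_fderiv ?_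
    have h3 : (‖x - C.centre ε i‖ ^ 2) ^ (-C.α / 2 - 1) =
        (‖x - C.centre ε i‖ ^ (C.α + 2))⁻¹ := by
      rw [← Real.rpow_natCast, ← Real.rpow_mul (norm_nonneg _), ← Real.rpow_neg (norm_nonneg _)]
      congr 1; push_cast; ring
    ext w
    simp only [h3, smul_apply, smul_eq_mul, nsmul_eq_mul]
    field_simp
    push_cast; ring
  have hV : HasFDerivAt (C.V ε)
      (∑ i, (-C.m i / ‖x - C.centre ε i‖ ^ (C.α + 2)) • innerSL ℝ (x - C.centre ε i)) x := by
    rw [V_eq_sum_rpow]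
    exact HasFDerivAt.fun_sum fun i _ => hterm i
  have hd : inner ℝ (gradient (C.V ε) x) w = fderiv ℝ (C.V ε) x w := by
    rw [← toDual_gradient]; simp
  rw [hd, hV.fderiv, sum_apply, ← Finset.sum_neg_distrib]
  refine Finset.sum_congr rfl fun i _ => ?_
  simp only [smul_apply, smul_eq_mul, innerSL_apply_apply]
  ring

/-- `d²/dt² |x|² / 2` along solutions at energy `-1` is positive near the circle of radius `R`, as
soon as it is for the total mass concentrated near the origin. -/
theorem two_mul_V_add_inner_gradient_nonneg (hη : 0 < η) (hηR : η < R)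
    (hM : 2 < C.mass * ((2 - C.α) / (C.α * (R + η) ^ C.α) - η / (R - η) ^ (C.α + 1)))
    (hc : ∀ i, ‖C.centre ε i‖ ≤ η / 2) (hx₁ : R - η / 2 ≤ ‖x‖) (hx₂ : ‖x‖ ≤ R + η / 2) :
    0 ≤ 2 * (C.V ε x - 1) + inner ℝ (gradient (C.V ε) x) x := by
  have hα := C.α_pos
  have hα2 := C.α_lt_two
  have hlo : ∀ i, R - η ≤ ‖x - C.centre ε i‖ := fun i => by
    have := norm_sub_norm_le x (C.centre ε i); linarith [hc i]
  have hhi : ∀ i, ‖x - C.centre ε i‖ ≤ R + η := fun i => by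
    have := norm_sub_le x (C.centre ε i); linarith [hc i]
  have hne : ∀ i, x ≠ C.centre ε i := fun i h => by
    have := hlo i; rw [h, sub_self, norm_zero] at this; linarith
  rw [C.inner_gradient_V hne]
  -- Compare mass by mass. With the centre at the origin the contribution would be `2 / (α d ^ α) -
  -- 1 / d ^ α = (2 - α) / (α d ^ α)`; the offset of the centre costs at most `η / d ^ (α + 1)`, and
  -- `R - η ≤ d ≤ R + η`.
  have key : C.mass * ((2 - C.α) / (C.α * (R + η) ^ C.α) - η / (R - η) ^ (C.α + 1)) ≤
      2 * C.V ε x - ∑ i, C.m i * inner ℝ (x - C.centre ε i) x / ‖x - C.centre ε i‖ ^ (C.α + 2) := by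
    rw [mass, V, Finset.sum_mul, Finset.mul_sum, ← Finset.sum_sub_distrib]
    refine Finset.sum_le_sum fun i _ => ?_
    set d := ‖x - C.centre ε i‖ with hd
    have hd0 : 0 < d := by linarith [hlo i]
    have hm := C.m_pos i
    have hin : inner ℝ (x - C.centre ε i) x ≤ d ^ 2 + η * d := by
      have h1 : inner ℝ (x - C.centre ε i) x =
          d ^ 2 + inner ℝ (x - C.centre ε i) (C.centre ε i) := by
        rw [hd, ← real_inner_self_eq_norm_sq, ← inner_add_right, sub_add_cancel]
      have h2 := real_inner_le_norm (x - C.centre ε i) (C.centre ε i)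
      rw [h1]
      have h3 : d * ‖C.centre ε i‖ ≤ d * η := by
        gcongr; linarith [hc i]
      linarith
    have e1 : d ^ (C.α + 2) = d ^ C.α * d ^ 2 := by
      rw [Real.rpow_add hd0]; norm_num
    have e2 : d ^ (C.α + 1) = d ^ C.α * d := by
      rw [Real.rpow_add hd0]; norm_num
    have hdα : 0 < d ^ C.α := Real.rpow_pos_of_pos hd0 _
    have h4 : C.m i * inner ℝ (x - C.centre ε i) x / d ^ (C.α + 2) ≤
        C.m i * (1 / d ^ C.α + η / d ^ (C.α + 1)) := by
      have : C.m i * (1 / d ^ C.α + η / d ^ (C.α + 1)) =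
          C.m i * (d ^ 2 + η * d) / d ^ (C.α + 2) := by
        rw [e1, e2]; field_simp
      rw [this]
      gcongr
    have h5 : (2 - C.α) / (C.α * (R + η) ^ C.α) ≤ (2 - C.α) / (C.α * d ^ C.α) := by
      gcongr
      exact hhi i
    have h6 : η / d ^ (C.α + 1) ≤ η / (R - η) ^ (C.α + 1) := by
      have : 0 < R - η := by linarith
      gcongr
      exact hlo i
    have h7 : 2 * (C.m i / (C.α * d ^ C.α)) =
        C.m i * ((2 - C.α) / (C.α * d ^ C.α) + 1 / d ^ C.α) := by
      field_simp; ring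
    have h8 : C.m i * ((2 - C.α) / (C.α * (R + η) ^ C.α) - η / (R - η) ^ (C.α + 1)) ≤
        C.m i * ((2 - C.α) / (C.α * d ^ C.α) - η / d ^ (C.α + 1)) := by
      gcongr
    rw [h7]
    linarith
  linarith

/-- Since `2 - α ≤ 1`, the margin `hM` already forces `mass / (α (R + η) ^ α) > 2`, and this
quotient is a lower bound for `V` in the ball. -/
theorem one_lt_V (hη : 0 < η) (hηR : η < R)
    (hM : 2 < C.mass * ((2 - C.α) / (C.α * (R + η) ^ C.α) - η / (R - η) ^ (C.α + 1)))
    (hc : ∀ i, ‖C.centre ε i‖ ≤ η / 2) (hx : ∀ i, x ≠ C.centre ε i) (hxR : ‖x‖ ≤ R) :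
    1 < C.V ε x := by
  have hα := C.one_le_α
  refine lt_of_lt_of_le ?_ (C.le_V_of_norm_sub_le hx (d := R + η) fun i => by
    have := norm_sub_le x (C.centre ε i); linarith [hc i])
  have hmass : 0 ≤ C.mass := Finset.sum_nonneg fun i _ => (C.m_pos i).le
  have h1 : 0 ≤ C.mass * (η / (R - η) ^ (C.α + 1)) := by
    have : 0 < R - η := by linarith
    positivity
  have h2 : 0 ≤ C.mass / (C.α * (R + η) ^ C.α) := by
    have : 0 < R := by linarith
    have := C.α_pos
    positivity
  have h3 : C.mass * ((2 - C.α) / (C.α * (R + η) ^ C.α) - η / (R - η) ^ (C.α + 1)) =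
      (2 - C.α) * (C.mass / (C.α * (R + η) ^ C.α)) - C.mass * (η / (R - η) ^ (C.α + 1)) := by ring
  nlinarith

/-- At `η = 0` the inequality is the hypothesis on `R`, rearranged; it persists for small `η` by
continuity. -/
theorem exists_convexity_margin (hR : 0 < R) (hRcirc : R ^ C.α < (2 - C.α) * C.mass / (2 * C.α)) :
    ∃ η > 0, η ≤ R / 4 ∧
      2 < C.mass * ((2 - C.α) / (C.α * (R + η) ^ C.α) - η / (R - η) ^ (C.α + 1)) := by
  have hα := C.α_pos
  have hRα : 0 < R ^ C.α := Real.rpow_pos_of_pos hR _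
  have hRα' : 0 < R ^ (C.α + 1) := Real.rpow_pos_of_pos hR _
  have hcont : ContinuousAt (fun η : ℝ =>
      C.mass * ((2 - C.α) / (C.α * (R + η) ^ C.α) - η / (R - η) ^ (C.α + 1))) 0 := by
    have h1 : ContinuousAt (fun η : ℝ => (R + η) ^ C.α) 0 :=
      (continuousAt_const.add continuousAt_id).rpow_const (Or.inr hα.le)
    have h2 : ContinuousAt (fun η : ℝ => (R - η) ^ (C.α + 1)) 0 :=
      (continuousAt_const.sub continuousAt_id).rpow_const (Or.inr (by linarith))
    refine continuousAt_const.mul ((continuousAt_const.div (continuousAt_const.mul h1) ?_).sub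
      (continuousAt_id.div h2 ?_))
    · change C.α * (R + 0) ^ C.α ≠ 0
      rw [add_zero]; positivity
    · change (R - 0) ^ (C.α + 1) ≠ 0
      rw [sub_zero]; positivity
  have h0 : 2 < C.mass * ((2 - C.α) / (C.α * (R + 0) ^ C.α) - 0 / (R - 0) ^ (C.α + 1)) := by
    rw [add_zero, zero_div, sub_zero, mul_div_assoc', lt_div_iff₀ (by positivity)]
    rw [lt_div_iff₀ (by positivity)] at hRcirc
    linarith
  have hev := hcont.eventually (lt_mem_nhds h0)
  obtain ⟨d, hd, hball⟩ := Metric.eventually_nhds_iff.1 hev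
  refine ⟨min (d / 2) (R / 4), by positivity, min_le_right _ _, hball ?_⟩
  rw [Real.dist_eq, sub_zero, abs_of_pos (by positivity)]
  exact (min_le_left _ _).trans_lt (by linarith)

/-! ### Solutions at energy `-1` -/

/-- Solutions in the region where `|x|²` is convex along solutions stay in the ball which contains
their ends. -/
theorem IsNewton.norm_le (hy : C.IsNewton ε T y) (hyc : ContinuousOn y (Icc 0 T))
    (hcol : ∀ t ∈ Ioo 0 T, ∀ i, y t ≠ C.centre ε i)
    (hconv : ∀ t ∈ Ioo 0 T, 0 ≤ 2 * (C.V ε (y t) - 1) + inner ℝ (gradient (C.V ε) (y t)) (y t))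
    (h0 : ‖y 0‖ ≤ R) (hT : ‖y T‖ ≤ R) {t : ℝ} (ht : t ∈ Icc 0 T) : ‖y t‖ ≤ R := by
  obtain ⟨v, hv⟩ := hy
  have hR : 0 ≤ R := (norm_nonneg _).trans h0
  -- The Lagrange–Jacobi identity: the second derivative of `|y|²` is `2 (⟨y, ∇V⟩ + |v|²)`, and
  -- `|v|² = 2 (V - 1)` by conservation of energy.
  have hcx : ConvexOn ℝ (Icc 0 T) (fun t => ‖y t‖ ^ 2) := by
    refine convexOn_of_hasDerivWithinAt2_nonneg (convex_Icc 0 T) (hyc.norm.pow 2)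
      (f' := fun t => 2 * inner ℝ (y t) (v t))
      (f'' := fun t => 2 * (inner ℝ (y t) (gradient (C.V ε) (y t)) + inner ℝ (v t) (v t)))
      ?_ ?_ ?_
    all_goals
      rw [interior_Icc]
      intro s hs
      have hsT := Ioo_subset_Icc_self hs
      obtain ⟨h1, h2, h3⟩ := hv s hsT (hcol s hs)
    · exact (h1.mono Ioo_subset_Icc_self).norm_sq
    · exact ((h1.mono Ioo_subset_Icc_self).inner ℝ (h2.mono Ioo_subset_Icc_self)).const_mul 2
    · have := hconv s hs
      rw [real_inner_self_eq_norm_sq, real_inner_comm]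
      linarith
  have hle := hcx.le_max_of_mem_Icc (left_mem_Icc.2 (ht.1.trans ht.2))
    (right_mem_Icc.2 (ht.1.trans ht.2)) ht
  have h2 : ‖y t‖ ^ 2 ≤ R ^ 2 := hle.trans (max_le (by gcongr) (by gcongr))
  exact (pow_le_pow_iff_left₀ (norm_nonneg _) hR two_ne_zero).1 h2

/-- Outside the ball `V` is bounded, hence so is the speed by the energy relation. -/
theorem IsOuterArc.L_lt_top {d : ℝ} (hy : C.IsOuterArc ε R p q T y) (hd : d < R)
    (hc : ∀ i, ‖C.centre ε i‖ ≤ d) : C.L ε 0 T y < ⊤ := by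
  obtain ⟨hT, -, -, -, hyR, v, hv⟩ := hy
  set B := C.mass / (C.α * (R - d) ^ C.α)
  have hdist : ∀ t ∈ Ioo 0 T, ∀ i, R - d ≤ ‖y t - C.centre ε i‖ := fun t ht i => by
    have := norm_sub_norm_le (y t) (C.centre ε i); linarith [hc i, hyR t ht]
  have hbd : C.L ε 0 T y ≤ ∫⁻ _ in Ioo 0 T, ENNReal.ofReal (√B * √(2 * B)) := by
    rw [L_eq_Ioo]
    refine setLIntegral_mono' measurableSet_Ioo fun t ht => ENNReal.ofReal_le_ofReal ?_
    have hV : C.V ε (y t) ≤ B := C.V_le_of_le_norm_sub (by linarith) (hdist t ht)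
    obtain ⟨h1, -, h3⟩ := hv t (Ioo_subset_Icc_self ht) fun i h => by
      have := hdist t ht i; rw [h, sub_self, norm_zero] at this; linarith
    rw [(h1.hasDerivAt (Icc_mem_nhds ht.1 ht.2)).deriv]
    gcongr
    · linarith
    · exact Real.le_sqrt_of_sq_le (by linarith)
  refine hbd.trans_lt ?_
  rw [setLIntegral_const]
  exact ENNReal.mul_lt_top ENNReal.ofReal_lt_top (by simp)

/-! ### Inner arcs -/

theorem Khat.mem_K (hu : C.Khat ε R S p q a b u) : C.K ε R S p q a b u := by
  obtain ⟨g, hg⟩ := hu.1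
  refine ⟨hu.1, fun _ => u, fun _ => g, (∫⁻ t in Icc a b, ‖g t‖ₑ ^ 2).toReal,
    fun _ => ⟨hu, hg, ?_⟩, ?_⟩
  · rw [ENNReal.ofReal_toReal (lintegral_enorm_sq_lt_top hg.1).ne]
  · rw [Metric.tendstoUniformlyOn_iff]
    intro e he
    exact Eventually.of_forall fun _ t _ => by simpa using he

theorem Khat.L_lt_top (hab : a ≤ b) (hu : C.Khat ε R S p q a b u) : C.L ε a b u < ⊤ := by
  obtain ⟨⟨g, hg⟩, -, -, -, hcol, -⟩ := hu
  have hc : ContinuousOn (fun t => C.V ε (u t)) (Icc a b) := fun t ht =>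
    (C.continuousAt_V (hcol t ht)).comp_continuousWithinAt (hg.continuousOn t ht)
  obtain ⟨B, hB⟩ := isCompact_Icc.bddAbove_image hc
  exact C.L_lt_top_of_bound hg hab fun t ht => hB (mem_image_of_mem _ ht)

theorem K.tendsto (hu : C.K ε R S p q a b u) {t : ℝ} (ht : t ∈ Icc a b) :
    ∃ un : ℕ → ℝ → ℂ, (∀ n, C.Khat ε R S p q a b (un n)) ∧
      Tendsto (fun n => un n t) atTop (𝓝 (u t)) := by
  obtain ⟨-, un, gn, B, h, hlim⟩ := hu
  exact ⟨un, fun n => (h n).1, hlim.tendsto_at ht⟩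

theorem K.left_eq (hu : C.K ε R S p q a b u) (hab : a ≤ b) : u a = p := by
  obtain ⟨un, h, hlim⟩ := K.tendsto C hu ⟨le_rfl, hab⟩
  exact tendsto_nhds_unique hlim (tendsto_const_nhds.congr fun n => (h n).2.1.symm)

theorem K.right_eq (hu : C.K ε R S p q a b u) (hab : a ≤ b) : u b = q := by
  obtain ⟨un, h, hlim⟩ := K.tendsto C hu ⟨hab, le_rfl⟩
  exact tendsto_nhds_unique hlim (tendsto_const_nhds.congr fun n => (h n).2.2.1.symm)

/-- At collisions of `y` the integrand may blow up. Finiteness comes from minimality, by comparison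
with one of the collision-free approximating curves. -/
theorem IsInnerArc.L_lt_top (hy : C.IsInnerArc ε R S p q T y) : C.L ε 0 T y < ⊤ := by
  obtain ⟨hT, -, -, ⟨-, un, gn, B, hun, -⟩, hmin⟩ := hy
  exact (hmin 0 T (un 0) hT (Khat.mem_K C (hun 0).1)).trans_lt (Khat.L_lt_top C hT.le (hun 0).1)

end NCentre

/-! ### Replacing the ends of an inner arc -/

namespace NCentre

variable {N : ℕ} {C : NCentre N} {ε R r r' η δ a b T T' T₁ T₂ s₁ s₂ ts : ℝ} {S : Set (Fin N)}
  {p p' q q' e₁ e₂ : ℂ} {U : Set ℂ} {y z β₁ β₂ γ γ₀ : ℝ → ℂ}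

/-- The curve `β₁` on `[0,T₁]`, a rest of unit time, `y` on `[s₁,s₂]`, a rest of unit time and `β₂`
on `[0,T₂]`, in this order and with the time of `y`. -/
noncomputable def chain (T₁ s₁ s₂ : ℝ) (β₁ y β₂ : ℝ → ℂ) (t : ℝ) : ℂ :=
  if t ≤ s₁ - 1 then β₁ (t - (s₁ - 1 - T₁))
  else if t ≤ s₁ then y s₁
  else if t ≤ s₂ then y t
  else if t ≤ s₂ + 1 then y s₂
  else β₂ (t - (s₂ + 1))

section chain

variable {t : ℝ}

theorem chain_of_le (h : t ≤ s₁ - 1) :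
    chain T₁ s₁ s₂ β₁ y β₂ t = β₁ (t - (s₁ - 1 - T₁)) := if_pos h

theorem chain_left_rest (hβ : β₁ T₁ = y s₁) (h : t ∈ Icc (s₁ - 1) s₁) :
    chain T₁ s₁ s₂ β₁ y β₂ t = y s₁ := by
  rcases eq_or_lt_of_le h.1 with rfl | h1
  · rw [chain_of_le le_rfl, ← hβ]; congr 1; ring
  · rw [chain, if_neg (not_le.2 h1), if_pos h.2]

theorem chain_of_mem (hβ : β₁ T₁ = y s₁) (h : t ∈ Icc s₁ s₂) :
    chain T₁ s₁ s₂ β₁ y β₂ t = y t := by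
  rcases eq_or_lt_of_le h.1 with rfl | h1
  · rw [chain_left_rest hβ ⟨by linarith, le_rfl⟩]
  · rw [chain, if_neg (by linarith), if_neg (not_le.2 h1), if_pos h.2]

theorem chain_right_rest (hβ : β₁ T₁ = y s₁) (hs : s₁ ≤ s₂) (h : t ∈ Icc s₂ (s₂ + 1)) :
    chain T₁ s₁ s₂ β₁ y β₂ t = y s₂ := by
  rcases eq_or_lt_of_le h.1 with rfl | h1
  · rw [chain_of_mem hβ ⟨hs, le_rfl⟩]
  · rw [chain, if_neg (by linarith), if_neg (by linarith), if_neg (not_le.2 h1), if_pos h.2]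

theorem chain_of_ge (hβ : β₁ T₁ = y s₁) (hβ₂ : β₂ 0 = y s₂) (hs : s₁ ≤ s₂) (h : s₂ + 1 ≤ t) :
    chain T₁ s₁ s₂ β₁ y β₂ t = β₂ (t - (s₂ + 1)) := by
  rcases eq_or_lt_of_le h with rfl | h1
  · rw [chain_right_rest hβ hs ⟨by linarith, le_rfl⟩, sub_self, hβ₂]
  · rw [chain, if_neg (by linarith), if_neg (by linarith), if_neg (by linarith),
      if_neg (not_le.2 h1)]

theorem isH1_chain (hT₁ : 0 ≤ T₁) (hT₂ : 0 ≤ T₂) (hs : s₁ ≤ s₂) (h₁ : IsH1 0 T₁ β₁)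
    (hy : IsH1 s₁ s₂ y) (h₂ : IsH1 0 T₂ β₂) (hβ₁ : β₁ T₁ = y s₁) (hβ₂ : β₂ 0 = y s₂) :
    IsH1 (s₁ - 1 - T₁) (s₂ + 1 + T₂) (chain T₁ s₁ s₂ β₁ y β₂) := by
  have g₁ := h₁.shift (s₁ - 1 - T₁)
  rw [zero_add, (by ring : T₁ + (s₁ - 1 - T₁) = s₁ - 1)] at g₁
  have g₂ := h₂.shift (s₂ + 1)
  rw [zero_add, add_comm T₂] at g₂
  have p₁ : IsH1 (s₁ - 1 - T₁) (s₁ - 1) (chain T₁ s₁ s₂ β₁ y β₂) :=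
    g₁.congr (by linarith) fun t ht => chain_of_le ht.2
  have p₂ : IsH1 (s₁ - 1) s₁ (chain T₁ s₁ s₂ β₁ y β₂) :=
    (IsH1.const (y s₁)).congr (by linarith) fun t ht => chain_left_rest hβ₁ ht
  have p₃ : IsH1 s₁ s₂ (chain T₁ s₁ s₂ β₁ y β₂) := hy.congr hs fun t ht => chain_of_mem hβ₁ ht
  have p₄ : IsH1 s₂ (s₂ + 1) (chain T₁ s₁ s₂ β₁ y β₂) :=
    (IsH1.const (y s₂)).congr (by linarith) fun t ht => chain_right_rest hβ₁ hs ht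
  have p₅ : IsH1 (s₂ + 1) (s₂ + 1 + T₂) (chain T₁ s₁ s₂ β₁ y β₂) :=
    g₂.congr (by linarith) fun t ht => chain_of_ge hβ₁ hβ₂ hs ht.1
  exact p₁.trans (p₂.trans (p₃.trans (p₄.trans p₅ (by linarith) (by linarith)) hs (by linarith))
    (by linarith) (by linarith)) (by linarith) (by linarith)

theorem L_chain (hT₁ : 0 ≤ T₁) (hT₂ : 0 ≤ T₂) (hs : s₁ ≤ s₂)
    (hβ₁ : β₁ T₁ = y s₁) (hβ₂ : β₂ 0 = y s₂) :
    C.L ε (s₁ - 1 - T₁) (s₂ + 1 + T₂) (chain T₁ s₁ s₂ β₁ y β₂) =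
      C.L ε 0 T₁ β₁ + C.L ε s₁ s₂ y + C.L ε 0 T₂ β₂ := by
  have l₁ : C.L ε (s₁ - 1 - T₁) (s₁ - 1) (chain T₁ s₁ s₂ β₁ y β₂) = C.L ε 0 T₁ β₁ := by
    rw [← C.L_shift ε 0 T₁ (s₁ - 1 - T₁), zero_add, (by ring : T₁ + (s₁ - 1 - T₁) = s₁ - 1)]
    exact C.L_congr fun t ht => chain_of_le ht.2.le
  have l₂ : C.L ε (s₁ - 1) s₁ (chain T₁ s₁ s₂ β₁ y β₂) = 0 := by
    rw [← C.L_const ε (s₁ - 1) s₁ (y s₁)]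
    exact C.L_congr fun t ht => chain_left_rest hβ₁ (Ioo_subset_Icc_self ht)
  have l₃ : C.L ε s₁ s₂ (chain T₁ s₁ s₂ β₁ y β₂) = C.L ε s₁ s₂ y :=
    C.L_congr fun t ht => chain_of_mem hβ₁ (Ioo_subset_Icc_self ht)
  have l₄ : C.L ε s₂ (s₂ + 1) (chain T₁ s₁ s₂ β₁ y β₂) = 0 := by
    rw [← C.L_const ε s₂ (s₂ + 1) (y s₂)]
    exact C.L_congr fun t ht => chain_right_rest hβ₁ hs (Ioo_subset_Icc_self ht)
  have l₅ : C.L ε (s₂ + 1) (s₂ + 1 + T₂) (chain T₁ s₁ s₂ β₁ y β₂) = C.L ε 0 T₂ β₂ := by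
    rw [← C.L_shift ε 0 T₂ (s₂ + 1), zero_add, add_comm T₂]
    exact C.L_congr fun t ht => chain_of_ge hβ₁ hβ₂ hs ht.1.le
  rw [C.L_add (b := s₁ - 1) (by linarith) (by linarith),
    C.L_add (a := s₁ - 1) (b := s₁) (by linarith) (by linarith),
    C.L_add (a := s₁) (b := s₂) hs (by linarith),
    C.L_add (a := s₂) (b := s₂ + 1) (by linarith) (by linarith), l₁, l₂, l₃, l₄, l₅]
  ring

end chain

/-- If the two ends of a curve of a class `K` are replaced by curves outside a disc which contains
the centres, the length of the result is an upper bound for the length of inner arcs. -/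
theorem IsInnerArc.L_le_of_K (hz : C.IsInnerArc ε R S (β₁ 0) (β₂ T₂) T' z)
    (hy : C.K ε R S p q a b y) (has : a ≤ s₁) (hs : s₁ ≤ s₂) (hsb : s₂ ≤ b)
    (hc : ∀ i, ‖C.centre ε i‖ < r) (hrr : r < r')
    (hr : ∀ t ∈ Icc a s₁ ∪ Icc s₂ b, r' ≤ ‖y t‖ ∧ ‖y t‖ ≤ R)
    (hT₁ : 0 ≤ T₁) (hT₂ : 0 ≤ T₂) (h₁ : IsH1 0 T₁ β₁) (h₂ : IsH1 0 T₂ β₂)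
    (hβ₁ : β₁ T₁ = y s₁) (hβ₂ : β₂ 0 = y s₂)
    (hr₁ : ∀ t ∈ Icc 0 T₁, r' ≤ ‖β₁ t‖ ∧ ‖β₁ t‖ ≤ R)
    (hr₂ : ∀ t ∈ Icc 0 T₂, r' ≤ ‖β₂ t‖ ∧ ‖β₂ t‖ ≤ R) (hp : ‖β₁ 0‖ = R) (hq : ‖β₂ T₂‖ = R) :
    C.L ε 0 T' z ≤ C.L ε 0 T₁ β₁ + C.L ε s₁ s₂ y + C.L ε 0 T₂ β₂ := by
  rw [← L_chain hT₁ hT₂ hs hβ₁ hβ₂]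
  refine hz.2.2.2.2 _ _ _ (by linarith) ?_
  have hH1 := isH1_chain hT₁ hT₂ hs h₁ (hy.1.mono ⟨has, hs.trans hsb⟩ ⟨has.trans hs, hsb⟩) h₂ hβ₁ hβ₂
  have e₁ : chain T₁ s₁ s₂ β₁ y β₂ (s₁ - 1 - T₁) = β₁ 0 := by
    rw [chain_of_le (by linarith), sub_self]
  have e₂ : chain T₁ s₁ s₂ β₁ y β₂ (s₂ + 1 + T₂) = β₂ T₂ := by
    rw [chain_of_ge hβ₁ hβ₂ hs (by linarith), add_sub_cancel_left]
  have hend : ∀ t ∈ Icc (s₁ - 1 - T₁) s₁ ∪ Icc s₂ (s₂ + 1 + T₂),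
      r' ≤ ‖chain T₁ s₁ s₂ β₁ y β₂ t‖ ∧ ‖chain T₁ s₁ s₂ β₁ y β₂ t‖ ≤ R := by
    rintro t (ht | ht)
    · rcases le_total t (s₁ - 1) with h | h
      · rw [chain_of_le h]; exact hr₁ _ ⟨by linarith [ht.1], by linarith⟩
      · rw [chain_left_rest hβ₁ ⟨h, ht.2⟩]; exact hr _ (Or.inl ⟨has, le_rfl⟩)
    · rcases le_total t (s₂ + 1) with h | h
      · rw [chain_right_rest hβ₁ hs ⟨ht.1, h⟩]; exact hr _ (Or.inr ⟨le_rfl, hsb⟩)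
      · rw [chain_of_ge hβ₁ hβ₂ hs h]; exact hr₂ _ ⟨by linarith, by linarith [ht.2]⟩
  -- The two rests in `chain` are the unit intervals on which `K.of_eqOn` needs a constant curve.
  have hK := K.of_eqOn hy has (by linarith) hs hsb (by linarith) hc hrr (fun t ht => (hr t ht).1)
    hH1 (fun t ht => (hend t ht).1) (fun t ht => (hend t ht).2) (fun t ht => chain_of_mem hβ₁ ht)
    (fun t ht => by
      rw [chain_left_rest hβ₁ ht, chain_left_rest hβ₁ ⟨by linarith, le_rfl⟩])
    (fun t ht => by
      rw [chain_right_rest hβ₁ hs ht, chain_right_rest hβ₁ hs ⟨le_rfl, by linarith⟩])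
    (by rw [e₁, hp]) (by rw [e₂, hq])
  rwa [e₁, e₂] at hK

/-! ### Comparison with geodesic arcs near the circle -/

/-- The conditions on `ε` and on the radius `η / 2` of neighbourhoods of points of the circle of
radius `R` under which geodesics near the circle are controlled. -/
structure IsMargin (C : NCentre N) (ε R η : ℝ) : Prop where
  pos : 0 < η
  le : η ≤ R / 4
  convex : 2 < C.mass * ((2 - C.α) / (C.α * (R + η) ^ C.α) - η / (R - η) ^ (C.α + 1))
  centre_le : ∀ i, ‖C.centre ε i‖ ≤ η / 2

theorem IsMargin.centre_lt (h : C.IsMargin ε R η) (i : Fin N) : ‖C.centre ε i‖ < R / 4 := by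
  linarith [h.centre_le i, h.pos, h.le]

theorem IsMargin.ne_centre (h : C.IsMargin ε R η) {x : ℂ} (hx : R / 2 ≤ ‖x‖) (i : Fin N) :
    x ≠ C.centre ε i := fun he => by
  have := h.centre_lt i
  rw [← he] at this
  linarith [h.pos, h.le]

theorem IsMargin.mem_jacobiDomain (h : C.IsMargin ε R η) {x : ℂ} (hx : R / 2 ≤ ‖x‖)
    (hxR : ‖x‖ ≤ R) : x ∈ C.jacobiDomain ε :=
  ⟨h.ne_centre hx, C.one_lt_V h.pos (by linarith [h.le, h.pos]) h.convex h.centre_le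
    (h.ne_centre hx) hxR⟩

/-- In `U` the geodesic is within `η / 2` of the circle, where `|x|²` is convex along solutions; so
it stays in the ball containing its ends. This makes it admissible as an end piece in the class `K`.
-/
theorem IsMargin.norm_geodesicArc (h : C.IsMargin ε R η) (hp : ‖p‖ = R)
    (hU : U ⊆ Metric.ball p (η / 2)) (hγ : C.IsGeodesicArc ε U e₁ e₂ T γ)
    (h₁ : R / 2 ≤ ‖e₁‖ ∧ ‖e₁‖ ≤ R) (h₂ : R / 2 ≤ ‖e₂‖ ∧ ‖e₂‖ ≤ R) :
    ∀ t ∈ Icc 0 T, R / 2 ≤ ‖γ t‖ ∧ ‖γ t‖ ≤ R := by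
  obtain ⟨hT, ⟨⟨hH1, he₁, he₂, -⟩, -⟩, hγU, hN⟩ := hγ
  have hpos := h.pos
  have hle := h.le
  have hnear : ∀ t ∈ Ioo 0 T, R - η / 2 ≤ ‖γ t‖ ∧ ‖γ t‖ ≤ R + η / 2 := fun t ht => by
    have h1 := hU (hγU t ht)
    rw [Metric.mem_ball, dist_eq_norm] at h1
    have h2 := norm_sub_norm_le p (γ t)
    have h3 := norm_sub_norm_le (γ t) p
    rw [norm_sub_rev] at h2
    exact ⟨by linarith, by linarith⟩
  intro t ht
  constructor
  · rcases eq_or_lt_of_le ht.1 with rfl | h0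
    · rw [he₁]; exact h₁.1
    · rcases eq_or_lt_of_le ht.2 with rfl | h0'
      · rw [he₂]; exact h₂.1
      · linarith [(hnear t ⟨h0, h0'⟩).1]
  · exact IsNewton.norm_le C hN hH1.continuousOn
      (fun s hs => h.ne_centre (by linarith [(hnear s hs).1]))
      (fun s hs => C.two_mul_V_add_inner_gradient_nonneg hpos (by linarith) h.convex h.centre_le
        (hnear s hs).1 (hnear s hs).2) (he₁ ▸ h₁.2) (he₂ ▸ h₂.2) ht

theorem IsMargin.L_geodesicArc_le (h : C.IsMargin ε R η) (hab : a ≤ b)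
    (hγ : C.IsGeodesicArc ε U (y a) (y b) T γ) (hy : IsH1 a b y)
    (hyR : ∀ t ∈ Icc a b, R / 2 ≤ ‖y t‖ ∧ ‖y t‖ ≤ R) : C.L ε 0 T γ ≤ C.L ε a b y :=
  hγ.2.1.2 a b y hab
    ⟨hy, rfl, rfl, fun t ht => h.mem_jacobiDomain (hyR t ht).1 (hyR t ht).2⟩

/-- Here `A`, `A'` are the old and new outer lengths, `X + Y` the old inner arc cut at `ts`, `Z` the
new inner arc, and `G`, `G'` the geodesics replacing `X`. The common piece `Y` has to be finite to
cancel. -/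
theorem add_le_add_of_add_le_of_split {A A' : ℝ≥0∞} {G G' X Y Z : ℝ≥0∞} (hY : Y ≠ ⊤)
    (h : A + (X + Y) ≤ A' + Z) (hX : G ≤ X) (hZ : Z ≤ G' + Y) : A + G ≤ A' + G' := by
  refine (ENNReal.add_le_add_iff_right hY).1 ?_
  calc A + G + Y ≤ A + X + Y := by gcongr
    _ = A + (X + Y) := add_assoc _ _ _
    _ ≤ A' + (G' + Y) := h.trans (by gcongr)
    _ = A' + G' + Y := (add_assoc _ _ _).symm

/-- Outer arcs followed by inner arcs: replacing the beginning of the inner arcs by geodesics. -/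
theorem IsMargin.add_le_of_start (h : C.IsMargin ε R η) {A A' : ℝ≥0∞}
    (hy : C.IsInnerArc ε R S p q T y) (hz : C.IsInnerArc ε R S p' q T' z)
    (hp : ‖p‖ = R) (hp' : ‖p'‖ = R) (hq : ‖q‖ = R) (hts : ts ∈ Ioo 0 T)
    (hyR : ∀ t ∈ Icc 0 ts, R / 2 ≤ ‖y t‖ ∧ ‖y t‖ ≤ R) (hU : U ⊆ Metric.ball p (η / 2))
    (hγ₀ : C.IsGeodesicArc ε U p (y ts) T₁ γ₀) (hγ : C.IsGeodesicArc ε U p' (y ts) T₂ γ)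
    (hA : A + C.L ε 0 T y ≤ A' + C.L ε 0 T' z) :
    A + C.L ε 0 T₁ γ₀ ≤ A' + C.L ε 0 T₂ γ := by
  have hT := hy.1
  have hR : 0 < R := by linarith [h.pos, h.le]
  have hK := hy.2.2.2.1
  have hadd := C.L_add (ε := ε) hts.1.le hts.2.le y
  have hfin := IsInnerArc.L_lt_top C hy
  have y0 := K.left_eq C hK hT.le
  have yT := K.right_eq C hK hT.le
  have hts' := hyR ts ⟨hts.1.le, le_rfl⟩
  rw [hadd] at hA hfin
  have hγ0 : γ 0 = p' := hγ.2.1.1.2.1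
  have hγT : γ T₂ = y ts := hγ.2.1.1.2.2.1
  refine add_le_add_of_add_le_of_split (ENNReal.add_lt_top.1 hfin).2.ne hA ?_ ?_
  · exact h.L_geodesicArc_le hts.1.le (by rwa [y0])
      (hK.1.mono ⟨le_rfl, hT.le⟩ (Ioo_subset_Icc_self hts)) hyR
  · have hz' : C.IsInnerArc ε R S (γ 0) ((fun _ : ℝ => y T) 0) T' z := by
      rw [hγ0]; simpa only [yT] using hz
    -- The competitor is `γ` followed by `y` after `ts`. The far end is unchanged, so its
    -- replacement is the constant curve on an interval of length zero.
    have := IsInnerArc.L_le_of_K (T₂ := 0) (β₂ := fun _ => y T) hz' hK hts.1.le hts.2.le le_rfl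
      h.centre_lt (by linarith : R / 4 < R / 2)
      (by
        rintro t (ht | ht)
        · exact hyR t ht
        · rw [le_antisymm ht.2 ht.1, yT, hq]; exact ⟨by linarith, le_rfl⟩)
      hγ.1.le le_rfl hγ.2.1.1.1 (IsH1.const _) hγT rfl
      (h.norm_geodesicArc hp hU hγ (by rw [hp']; exact ⟨by linarith, le_rfl⟩) hts')
      (fun t _ => by simp only [yT, hq]; exact ⟨by linarith, le_rfl⟩)
      (by rw [hγ0, hp']) (by simp only [yT, hq])
    rwa [C.L_const, add_zero] at this

/-- Inner arcs followed by outer arcs: replacing the end of the inner arcs by geodesics. -/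
theorem IsMargin.add_le_of_end (h : C.IsMargin ε R η) {A A' : ℝ≥0∞}
    (hy : C.IsInnerArc ε R S p q T y) (hz : C.IsInnerArc ε R S p q' T' z)
    (hp : ‖p‖ = R) (hq : ‖q‖ = R) (hq' : ‖q'‖ = R) (hts : ts ∈ Ioo 0 T)
    (hyR : ∀ t ∈ Icc ts T, R / 2 ≤ ‖y t‖ ∧ ‖y t‖ ≤ R) (hU : U ⊆ Metric.ball q (η / 2))
    (hγ₀ : C.IsGeodesicArc ε U (y ts) q T₁ γ₀) (hγ : C.IsGeodesicArc ε U (y ts) q' T₂ γ)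
    (hA : A + C.L ε 0 T y ≤ A' + C.L ε 0 T' z) :
    A + C.L ε 0 T₁ γ₀ ≤ A' + C.L ε 0 T₂ γ := by
  have hT := hy.1
  have hR : 0 < R := by linarith [h.pos, h.le]
  have hK := hy.2.2.2.1
  have hadd := C.L_add (ε := ε) hts.1.le hts.2.le y
  have hfin := IsInnerArc.L_lt_top C hy
  have y0 := K.left_eq C hK hT.le
  have yT := K.right_eq C hK hT.le
  have hts' := hyR ts ⟨le_rfl, hts.2.le⟩
  -- Now the piece after `ts` is replaced and the piece before it is kept and cancelled.
  rw [hadd, add_comm (C.L ε 0 ts y)] at hA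
  rw [hadd] at hfin
  have hγ0 : γ 0 = y ts := hγ.2.1.1.2.1
  have hγT : γ T₂ = q' := hγ.2.1.1.2.2.1
  refine add_le_add_of_add_le_of_split (ENNReal.add_lt_top.1 hfin).1.ne hA ?_ ?_
  · exact h.L_geodesicArc_le hts.2.le (by rwa [yT])
      (hK.1.mono (Ioo_subset_Icc_self hts) ⟨hT.le, le_rfl⟩) hyR
  · have hz' : C.IsInnerArc ε R S ((fun _ : ℝ => y 0) 0) (γ T₂) T' z := by
      rw [hγT]; simpa only [y0] using hz
    have := IsInnerArc.L_le_of_K (T₁ := 0) (β₁ := fun _ => y 0) hz' hK le_rfl hts.1.le hts.2.le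
      h.centre_lt (by linarith : R / 4 < R / 2)
      (by
        rintro t (ht | ht)
        · rw [le_antisymm ht.2 ht.1, y0, hp]; exact ⟨by linarith, le_rfl⟩
        · exact hyR t ht)
      le_rfl hγ.1.le (IsH1.const _) hγ.2.1.1.1 rfl hγ0
      (fun t _ => by simp only [y0, hp]; exact ⟨by linarith, le_rfl⟩)
      (h.norm_geodesicArc hq hU hγ hts' (by rw [hq']; exact ⟨by linarith, le_rfl⟩))
      (by simp only [y0, hp]) (by rw [hγT, hq'])
    rwa [C.L_const, zero_add, add_comm] at this

end NCentre

/-! ### Chains of arcs -/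

/-- Two indices are needed because an even point joins inner arc `i` to outer arc `j = i + 1` modulo
`n`. Only the old lengths must be finite, since the unchanged terms are the ones that cancel. -/
theorem ENNReal.add_le_add_of_sum_le {ι : Type*} [Fintype ι] [DecidableEq ι] {A A' B B' : ι → ℝ≥0∞}
    (i j : ι) (hA : ∀ k, A k ≠ ⊤) (hB : ∀ k, B k ≠ ⊤) (hAA' : ∀ k, k ≠ j → A' k = A k)
    (hBB' : ∀ k, k ≠ i → B' k = B k) (h : ∑ k, (A k + B k) ≤ ∑ k, (A' k + B' k)) :
    A j + B i ≤ A' j + B' i := by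
  have e₁ : ∑ k ∈ Finset.univ.erase j, A' k = ∑ k ∈ Finset.univ.erase j, A k :=
    Finset.sum_congr rfl fun k hk => hAA' k (Finset.ne_of_mem_erase hk)
  have e₂ : ∑ k ∈ Finset.univ.erase i, B' k = ∑ k ∈ Finset.univ.erase i, B k :=
    Finset.sum_congr rfl fun k hk => hBB' k (Finset.ne_of_mem_erase hk)
  rw [Finset.sum_add_distrib, Finset.sum_add_distrib, ← Finset.add_sum_erase _ A (Finset.mem_univ j),
    ← Finset.add_sum_erase _ B (Finset.mem_univ i), ← Finset.add_sum_erase _ A' (Finset.mem_univ j),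
    ← Finset.add_sum_erase _ B' (Finset.mem_univ i), e₁, e₂, add_add_add_comm,
    add_add_add_comm (A' j)] at h
  refine (ENNReal.add_le_add_iff_right ?_).1 h
  exact ENNReal.add_ne_top.2 ⟨ENNReal.sum_ne_top.2 fun k _ => hA k, ENNReal.sum_ne_top.2 fun k _ => hB k⟩

theorem finRotate_symm_val {n : ℕ} (j : Fin n) :
    (j : ℕ) = (finRotate n).symm j + 1 ∨ ((j : ℕ) = 0 ∧ ((finRotate n).symm j : ℕ) + 1 = n) := by
  obtain ⟨i, rfl⟩ := (finRotate n).surjective j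
  rw [Equiv.symm_apply_apply]
  rcases n with - | n
  · exact i.elim0
  · by_cases hi : i = Fin.last n
    · right; simp [hi]
    · left; rw [coe_finRotate_of_ne_last hi]

namespace NCentre

variable {N : ℕ} {C : NCentre N} {ε R η δ : ℝ} {Text : ℂ → ℂ → ℝ} {yext : ℂ → ℂ → ℝ → ℂ}
  {Tin : Set (Fin N) → ℂ → ℂ → ℝ} {yin : Set (Fin N) → ℂ → ℂ → ℝ → ℂ}
  {n : ℕ} {S : Fin n → Set (Fin N)} {pbar : Fin (2 * n + 1) → ℂ}

theorem IsMargin.L_outer_ne_top (h : C.IsMargin ε R η) (hext : C.IsOuterFamily ε R δ Text yext)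
    (hpbar : pbar ∈ domF R δ n) (k : Fin n) :
    C.L ε 0 (Text (pbar (ev k)) (pbar (od k))) (yext (pbar (ev k)) (pbar (od k))) ≠ ⊤ :=
  (IsOuterArc.L_lt_top C (hext _ (hpbar.1 _) _ (hpbar.1 _) (hpbar.2.2 k))
    (by linarith [h.pos, h.le] : η / 2 < R) h.centre_le).ne

theorem L_inner_ne_top (hin : C.IsInnerFamily ε R Tin yin)
    (hS : ∀ j, (S j).Nonempty ∧ (S j)ᶜ.Nonempty) (hpbar : pbar ∈ domF R δ n) (k : Fin n) :
    C.L ε 0 (Tin (S k) (pbar (od k)) (pbar (ev' k)))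
      (yin (S k) (pbar (od k)) (pbar (ev' k))) ≠ ⊤ :=
  (IsInnerArc.L_lt_top C (hin _ (hS k).1 (hS k).2 _ (hpbar.1 _) _ (hpbar.1 _))).ne

/-- Moving one point with odd index of a minimizing chain. -/
theorem IsMargin.minimizer_odd (h : C.IsMargin ε R η) (hext : C.IsOuterFamily ε R δ Text yext)
    (hin : C.IsInnerFamily ε R Tin yin) (hS : ∀ j, (S j).Nonempty ∧ (S j)ᶜ.Nonempty)
    (hmin : IsMinimizer (C.F ε Text yext Tin yin S) (domF R δ n) pbar) (j : Fin n) {x : ℂ}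
    (hx : x ∈ Metric.sphere (0 : ℂ) R) (hxδ : ‖pbar (ev j) - x‖ ≤ δ) :
    C.L ε 0 (Text (pbar (ev j)) (pbar (od j))) (yext (pbar (ev j)) (pbar (od j))) +
        C.L ε 0 (Tin (S j) (pbar (od j)) (pbar (ev' j))) (yin (S j) (pbar (od j)) (pbar (ev' j))) ≤
      C.L ε 0 (Text (pbar (ev j)) x) (yext (pbar (ev j)) x) +
        C.L ε 0 (Tin (S j) x (pbar (ev' j))) (yin (S j) x (pbar (ev' j))) := by
  set p' : Fin (2 * n + 1) → ℂ := fun k => if k = od j then x else pbar k with hp'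
  have hev : ∀ k, p' (ev k) = pbar (ev k) := fun k =>
    if_neg (by simp only [ev, od, Fin.ext_iff]; omega)
  have hev' : ∀ k, p' (ev' k) = pbar (ev' k) := fun k =>
    if_neg (by simp only [ev', od, Fin.ext_iff]; omega)
  have hod : ∀ k, k ≠ j → p' (od k) = pbar (od k) := fun k hk =>
    if_neg (by simp only [od, Fin.ext_iff] at hk ⊢; omega)
  have hodj : p' (od j) = x := if_pos rfl
  have hdom : p' ∈ domF R δ n := by
    refine ⟨fun k => ?_, ?_, fun k => ?_⟩
    · by_cases hk : k = od j
      · simpa only [hp', if_pos hk] using hx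
      · simpa only [hp', if_neg hk] using hmin.1.1 k
    · have h1 : Fin.last (2 * n) ≠ od j := by simp only [Ne, od, Fin.ext_iff, Fin.val_last]; omega
      have h2 : (0 : Fin (2 * n + 1)) ≠ od j := by
        simp only [Ne, od, Fin.ext_iff, Fin.val_zero]; omega
      simpa only [hp', if_neg h1, if_neg h2] using hmin.1.2.1
    · rw [hev]
      by_cases hk : k = j
      · rw [hk, hodj]; exact hxδ
      · rw [hod k hk]; exact hmin.1.2.2 k
  have hle := isMinOn_iff.1 hmin.2 p' hdom
  have := ENNReal.add_le_add_of_sum_le j j (h.L_outer_ne_top hext hmin.1)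
    (L_inner_ne_top hin hS hmin.1) (fun k hk => by rw [hev, hod k hk])
    (fun k hk => by rw [hev', hod k hk]) hle
  rwa [hev, hev', hodj] at this

/-- Moving one point with even index of a minimizing chain. -/
theorem IsMargin.minimizer_even (h : C.IsMargin ε R η) (hext : C.IsOuterFamily ε R δ Text yext)
    (hin : C.IsInnerFamily ε R Tin yin) (hS : ∀ j, (S j).Nonempty ∧ (S j)ᶜ.Nonempty)
    (hmin : IsMinimizer (C.F ε Text yext Tin yin S) (domF R δ n) pbar) {i j : Fin n}
    (hij : (j : ℕ) = i + 1 ∨ ((j : ℕ) = 0 ∧ (i : ℕ) + 1 = n)) {x : ℂ}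
    (hx : x ∈ Metric.sphere (0 : ℂ) R) (hxδ : ‖pbar (od j) - x‖ ≤ δ) :
    C.L ε 0 (Text (pbar (ev j)) (pbar (od j))) (yext (pbar (ev j)) (pbar (od j))) +
        C.L ε 0 (Tin (S i) (pbar (od i)) (pbar (ev' i))) (yin (S i) (pbar (od i)) (pbar (ev' i))) ≤
      C.L ε 0 (Text x (pbar (od j))) (yext x (pbar (od j))) +
        C.L ε 0 (Tin (S i) (pbar (od i)) x) (yin (S i) (pbar (od i)) x) := by
  -- The indices `2j` and `2i + 2` coincide, except for `j = 0`, where they are `0` and `2n`; then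
  -- both copies of the point must move together.
  set p' : Fin (2 * n + 1) → ℂ := fun k => if k = ev j ∨ k = ev' i then x else pbar k with hp'
  have hod : ∀ k, p' (od k) = pbar (od k) := fun k =>
    if_neg (by simp only [ev, ev', od, Fin.ext_iff]; omega)
  have hev : ∀ k, k ≠ j → p' (ev k) = pbar (ev k) := fun k hk =>
    if_neg (by simp only [ev, ev', Fin.ext_iff] at hk ⊢; omega)
  have hev' : ∀ k, k ≠ i → p' (ev' k) = pbar (ev' k) := fun k hk =>
    if_neg (by simp only [ev, ev', Ne, Fin.ext_iff] at hk ⊢; omega)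
  have hevj : p' (ev j) = x := if_pos (Or.inl rfl)
  have hevi : p' (ev' i) = x := if_pos (Or.inr rfl)
  have hdom : p' ∈ domF R δ n := by
    refine ⟨fun k => ?_, ?_, fun k => ?_⟩
    · by_cases hk : k = ev j ∨ k = ev' i
      · simpa only [hp', if_pos hk] using hx
      · simpa only [hp', if_neg hk] using hmin.1.1 k
    · rcases hij with hij | hij
      · have h1 : ¬ (Fin.last (2 * n) = ev j ∨ Fin.last (2 * n) = ev' i) := by
          simp only [ev, ev', Fin.ext_iff, Fin.val_last]; omega
        have h2 : ¬ ((0 : Fin (2 * n + 1)) = ev j ∨ (0 : Fin (2 * n + 1)) = ev' i) := by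
          simp only [ev, ev', Fin.ext_iff, Fin.val_zero]; omega
        simpa only [hp', if_neg h1, if_neg h2] using hmin.1.2.1
      · have h1 : Fin.last (2 * n) = ev' i := by
          simp only [ev', Fin.ext_iff, Fin.val_last]; omega
        have h2 : (0 : Fin (2 * n + 1)) = ev j := by
          simp only [ev, Fin.ext_iff, Fin.val_zero]; omega
        rw [h1, h2, hevj, hevi]
    · rw [hod]
      by_cases hk : k = j
      · rw [hk, hevj, norm_sub_rev]; exact hxδ
      · rw [hev k hk]; exact hmin.1.2.2 k
  have hle := isMinOn_iff.1 hmin.2 p' hdom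
  have := ENNReal.add_le_add_of_sum_le i j (h.L_outer_ne_top hext hmin.1)
    (L_inner_ne_top hin hS hmin.1) (fun k hk => by rw [hod, hev k hk])
    (fun k hk => by rw [hod, hev' k hk]) hle
  rwa [hod, hod, hevj, hevi] at this

theorem apply_ev'_eq (hpbar : pbar ∈ domF R δ n) {i j : Fin n}
    (hij : (j : ℕ) = i + 1 ∨ ((j : ℕ) = 0 ∧ (i : ℕ) + 1 = n)) : pbar (ev' i) = pbar (ev j) := by
  rcases hij with hij | hij
  · congr 1; simp only [ev, ev', Fin.ext_iff]; omega
  · have h1 : ev' i = Fin.last (2 * n) := by simp only [ev', Fin.ext_iff, Fin.val_last]; omega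
    have h2 : ev j = (0 : Fin (2 * n + 1)) := by simp only [ev, Fin.ext_iff, Fin.val_zero]; omega
    rw [h1, h2, hpbar.2.1]

/-- The margin `η` depends only on `R`, `α` and the masses; `ε₀` then makes every `ε |c i|` at most
`η / 2`. -/
theorem exists_forall_isMargin (C : NCentre N) (hR : 0 < R)
    (hRcirc : R ^ C.α < (2 - C.α) * C.mass / (2 * C.α)) :
    ∃ ε₀ > 0, ∃ η > 0, ∀ ε, 0 < ε → ε < ε₀ → C.IsMargin ε R η := by
  obtain ⟨η, hη, hηR, hM⟩ := C.exists_convexity_margin hR hRcirc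
  have hsum : 0 ≤ ∑ i, ‖C.c i‖ := Finset.sum_nonneg fun i _ => norm_nonneg _
  refine ⟨η / 2 / (∑ i, ‖C.c i‖ + 1), by positivity, η, hη, fun ε hε hε₀ =>
    ⟨hη, hηR, hM, fun i => ?_⟩⟩
  rw [lt_div_iff₀ (by positivity)] at hε₀
  have hi : ‖C.c i‖ ≤ ∑ i, ‖C.c i‖ :=
    Finset.single_le_sum (f := fun i => ‖C.c i‖) (fun i _ => norm_nonneg _) (Finset.mem_univ i)
  rw [centre, norm_mul, Complex.norm_of_nonneg hε.le]
  nlinarith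

end NCentre

/-! ### Minimality of the localized functions -/

theorem mainTheorem4 {N : ℕ} (C : NCentre N) (R : ℝ) (hR : 0 < R)
    (hRcirc : R ^ C.α < (2 - C.α) * C.mass / (2 * C.α)) :
    ∃ ε₀ > 0, ∃ ρ > 0, ∀ ε : ℝ, 0 < ε → ε < ε₀ → ∀ δ : ℝ, 0 < δ →
    ∀ (Text : ℂ → ℂ → ℝ) (yext : ℂ → ℂ → ℝ → ℂ)
      (Tin : Set (Fin N) → ℂ → ℂ → ℝ) (yin : Set (Fin N) → ℂ → ℂ → ℝ → ℂ),
    C.IsOuterFamily ε R δ Text yext → C.IsInnerFamily ε R Tin yin →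
    ∀ (n : ℕ) (S : Fin n → Set (Fin N)), (∀ j, (S j).Nonempty ∧ (S j)ᶜ.Nonempty) →
    ∀ pbar : Fin (2 * n + 1) → ℂ,
    IsMinimizer (C.F ε Text yext Tin yin S) (NCentre.domF R δ n) pbar →
    ∀ j : Fin n,
      -- odd index: `k = 2 j + 1`
      (∀ (U : Set ℂ) (ts : ℝ) (Tgeo : ℂ → ℝ) (ygeo : ℂ → ℝ → ℂ),
        let y := yin (S j) (pbar (NCentre.od j)) (pbar (NCentre.ev' j))
        let T := Tin (S j) (pbar (NCentre.od j)) (pbar (NCentre.ev' j))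
        let q := pbar (NCentre.ev j)
        U ∈ 𝓝 (pbar (NCentre.od j)) → U ⊆ Metric.ball (pbar (NCentre.od j)) ρ →
        C.IsStronglyConvex ε U →
        ts ∈ Ioo 0 T → y ts ∈ U → ‖y ts‖ < R →
        (∀ t ∈ Icc 0 ts, R / 2 ≤ ‖y t‖ ∧ ‖y t‖ ≤ R) →
        (∀ p ∈ NCentre.domG R δ U q, C.IsGeodesicArc ε U p (y ts) (Tgeo p) (ygeo p)) →
        IsMinimizer (C.Godd ε Text yext Tgeo ygeo q) (NCentre.domG R δ U q)
          (pbar (NCentre.od j))) ∧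
      -- even index: `k = 2 j`; the preceding inner arc is number `i = j - 1` modulo `n`
      (∀ (U : Set ℂ) (ts : ℝ) (Tgeo : ℂ → ℝ) (ygeo : ℂ → ℝ → ℂ),
        let i := (finRotate n).symm j
        let y := yin (S i) (pbar (NCentre.od i)) (pbar (NCentre.ev' i))
        let T := Tin (S i) (pbar (NCentre.od i)) (pbar (NCentre.ev' i))
        let q := pbar (NCentre.od j)
        U ∈ 𝓝 (pbar (NCentre.ev j)) → U ⊆ Metric.ball (pbar (NCentre.ev j)) ρ →
        C.IsStronglyConvex ε U →
        ts ∈ Ioo 0 T → y ts ∈ U → ‖y ts‖ < R →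
        (∀ t ∈ Icc ts T, R / 2 ≤ ‖y t‖ ∧ ‖y t‖ ≤ R) →
        (∀ p ∈ NCentre.domG R δ U q, C.IsGeodesicArc ε U (y ts) p (Tgeo p) (ygeo p)) →
        IsMinimizer (C.Geven ε Text yext Tgeo ygeo q) (NCentre.domG R δ U q)
          (pbar (NCentre.ev j))) := by
  obtain ⟨ε₀, hε₀, η, hη, hmargin⟩ := C.exists_forall_isMargin hR hRcirc
  refine ⟨ε₀, hε₀, η / 2, by positivity, ?_⟩
  intro ε hε hεε₀ δ _ Text yext Tin yin hext hin n S hS pbar hmin j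
  have h := hmargin ε hε hεε₀
  have hsph : ∀ k, ‖pbar k‖ = R := fun k => mem_sphere_zero_iff_norm.1 (hmin.1.1 k)
  constructor
  · intro U ts Tgeo ygeo y T q hU hUρ _ hts _ _ hyR hgeo
    have hmem : pbar (NCentre.od j) ∈ NCentre.domG R δ U q :=
      ⟨⟨hmin.1.1 _, subset_closure (mem_of_mem_nhds hU)⟩, hmin.1.2.2 j⟩
    refine ⟨hmem, isMinOn_iff.2 fun x hx => ?_⟩
    exact h.add_le_of_start (hin _ (hS j).1 (hS j).2 _ (hmin.1.1 _) _ (hmin.1.1 _))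
      (hin _ (hS j).1 (hS j).2 x hx.1.1 _ (hmin.1.1 _)) (hsph _)
      (mem_sphere_zero_iff_norm.1 hx.1.1) (hsph _) hts hyR hUρ (hgeo _ hmem) (hgeo x hx)
      (h.minimizer_odd hext hin hS hmin j hx.1.1 hx.2)
  · intro U ts Tgeo ygeo i y T q hU hUρ _ hts _ _ hyR hgeo
    have hij := finRotate_symm_val j
    -- The preceding inner arc ends at the point with index `2i + 2`; this identifies it with the
    -- point `2j`, also across the closure of the chain.
    have hpe := NCentre.apply_ev'_eq hmin.1 hij
    have hmem : pbar (NCentre.ev j) ∈ NCentre.domG R δ U q :=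
      ⟨⟨hmin.1.1 _, subset_closure (mem_of_mem_nhds hU)⟩, by
        rw [norm_sub_rev]; exact hmin.1.2.2 j⟩
    refine ⟨hmem, isMinOn_iff.2 fun x hx => ?_⟩
    have hg := hgeo _ hmem
    have hle := h.add_le_of_end (hin _ (hS i).1 (hS i).2 _ (hmin.1.1 _) _ (hmin.1.1 _))
      (hin _ (hS i).1 (hS i).2 _ (hmin.1.1 _) x hx.1.1) (hsph _) (hsph _)
      (mem_sphere_zero_iff_norm.1 hx.1.1) hts hyR (hpe ▸ hUρ) (hpe ▸ hg) (hgeo x hx)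
      (h.minimizer_even hext hin hS hmin hij hx.1.1 hx.2)
    unfold NCentre.Geven
    rw [add_comm, add_comm (C.L ε 0 (Tgeo x) (ygeo x))]
    rw [hpe] at hle
    exact hle
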